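/- **Setting.** An XZ-Hamiltonian on $n$ qubits is $H=\sum_i a_iS_i$ with real $a_i$ and $S_i$ a tensor product of factors $I,X,Z$ with at most one factor $X$ and at most one factor $Z$; put $\|a\|_1=\sum_i|a_i|$. In the post hoc protocol of Morimae and Fitzsimons the prover sends an $n$-qubit state $\rho$; the verifier chooses $i$ with probability $|a_i|/\|a\|_1$, measures the factors of $S_i$ by single-qubit $X$ and $Z$ measurements, and accepts if the product of the outcomes is $-\mathrm{sgn}(a_i)$. Let $p_H(\rho)$ be the acceptance probability. Let $Q$ be a CSS code encoding one qubit into $m$ qubits, given by binary codes $C_2\subseteq C_1$ with $\dim C_1=\dim C_2+1$, with logical operators $\tilde X,\tilde Z$ that are products of physical $X$'s along a word $l_X\in C_1$, respectively of physical $Z$'s along a word $l_Z\in C_2^\perp$, $l_X\cdot l_Z=1$ (for all-ones words, $\tilde X=X^{\otimes m}$ and $\tilde Z=Z^{\otimes m}$). Concatenating $k$ times gives blocks of $m^k$ qubits; write $\tilde\psi,\tilde\rho$ for states encoded blockwise and $\tilde H=\sum_ia_i\tilde S_i$ for the Hamiltonian with each $I,X,Z$ replaced by its logical version. In the fault tolerant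 protocol the prover sends a state of the $nm^k$ physical qubits; the verifier chooses $i$ as before, measures all qubits of each block belonging to a factor $X$ (or $Z$) of $S_i$ individually in the basis $X$ (or $Z$), decodes the outcomes of each block classically, level by level, with syndrome decoders for $C_2^\perp$ (for $X$) and $C_1$ (for $Z$), and accepts if the product of the decoded outcomes is $-\mathrm{sgn}(a_i)$. Measurement noise of rate $\epsilon\in[0,1]$: before an ideal measurement each physical qubit independently undergoes $(1-\epsilon)\,\mathrm{id}+\epsilon\,\mathcal N$, where $\mathcal N$ is an arbitrary single-qubit channel. Let $\tilde p_H(\sigma)$ be the acceptance probability on a physical state $\sigma$. **Theorem.** (1) For every $k$ there is a unitary $E$ on a block with $E(X\otimes I)E^\dagger=\tilde X$ and $E(Z\otimes I)E^\dagger=\tilde Z$ such that, for all $n$, $H$ and $\psi$, $E^{\otimes n}(H\otimes I)(E^{\otimes n})^\dagger=\tilde H$ and $E^{\otimes n}|\psi\rangle|0\cdots0\rangle=|\tilde\psi\rangle$. Hence $\tilde H$ and $H$ have the same spectrum and the same lower energy bounds (so the same promise gap), $\langle\tilde\psi|\tilde H|\tilde\psi\rangle=\langle\psi|H|\psi\rangle$,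 and encoded ground states of $H$ are ground states of $\tilde H$. (2) There is $\alpha>0$, depending only on the code, such that for all decoders that correct every error on at most one qubit of a block: (a) For all $\epsilon\in[0,1]$, all $\mathcal N$ and all $k$, put $p_k=\alpha^{2^k-1}\epsilon^{2^k}$. If an encoded eigenstate of $X$ or $Z$ is measured in that basis with noise, the decoded outcome is wrong with probability at most $p_k$. More generally, for every encoded $n$-qubit state and every choice of $w$ qubits to be measured in the $X$ or $Z$ basis, the decoded noisy outcomes have total variation distance at most $w\,p_k$ from the ideal outcomes on the unencoded state. (b) If $p_k\le\eta/2$ and $\|a\|_1>0$, then $\tilde p_H(\tilde\rho)\ge p_H(\rho)-\eta$ for every $n$-qubit state $\rho$, and if $p_H(\rho)\le p$ for all $n$-qubit states $\rho$, then $\tilde p_H(\sigma)\le p+\eta$ for every state $\sigma$ of the physical qubits (an encoded state or not). (c) Let $\epsilon<1/\alpha$. For every $\eta\in(0,1]$ there is $k$ with $p_k\le\eta/2$ and, if $\epsilon>0$, $m^k\le m\,\max\bigl(1,\tfrac{\log(2/\alpha\eta)}{\log(1/\alpha\epsilon)}\bigr)^{\log_2m}$; moreover $m^k\le C\log(2/\eta)^c$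 with $C,c$ independent of $\eta$. (d) Let $\epsilon<1/\alpha$ and $d,e\in\mathbb N$. There are functions $k(N)$, $\eta(N)$ of the input length $N$ and constants $C,c,d'$ such that $n$ logical qubits are encoded in at most $n\,C\log(N+2)^c$ physical qubits and the following holds for every $H$ and all reals $a,b$ with $a-b\ge(N+2)^{-d}$ and $0<\|a\|_1\le(N+2)^e$. With $k(N)$ levels of concatenation, if $\psi$ has energy at most $b$ then the encoded state is accepted with probability at least $s_+=\frac12(1-b/\|a\|_1)-\eta(N)$; if all energies of $H$ are at least $a$ then every physical state is accepted with probability at most $s_-=\frac12(1-a/\|a\|_1)+\eta(N)$; and $s_+-s_-\ge(N+2)^{-d'}$. In particular, suppose that to the inputs $x$ of length $N$ are assigned such Hamiltonians $H_x$ and thresholds $a_x,b_x$ so that for $x\in L$ the Feynman–Kitaev history state of a quantum circuit assigned to $x$ has energy at most $b_x$, and for $x\notin L$ all energies are at least $a_x$ (as in the post hoc protocol for a language $L$ in $\mathsf{BQP}$). Then the fault tolerant protocol, with the honest prover sending the encoded history state, accepts with probability at least $s_+$ if $x\in L$, and at most $s_-$ whatever the prover sends if $x\notin L$. -/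

import Mathlib

open Matrix
open scoped ComplexOrder

noncomputable section

/-! ## Qubit registers and product operators -/

/-- Computational-basis strings of a register of qubits indexed by `ι`. -/
abbrev Reg (ι : Type) : Type := ι → ZMod 2

/-- Operators on the register of qubits indexed by `ι`. -/
abbrev Op (ι : Type) : Type := Matrix (Reg ι) (Reg ι) ℂ

/-- Operators on a single qubit. -/
abbrev QubitOp : Type := Matrix (ZMod 2) (ZMod 2) ℂ

/-- The labels `I`, `X`, `Z` of the single-qubit factors of an XZ-term. -/
inductive XZ : Type
  | I
  | X
  | Z
  deriving DecidableEq

/-- The Pauli matrices `I`, `X`, `Z`. -/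
def pauli : XZ → QubitOp
  | XZ.I => 1
  | XZ.X => Matrix.of fun s t => if s = t then 0 else 1
  | XZ.Z => Matrix.diagonal fun s => if s = 0 then 1 else -1

/-- The tensor product of single-qubit operators. -/
def tensorOp {ι : Type} [Fintype ι] (A : ι → QubitOp) : Op ι :=
  Matrix.of fun s t => ∏ i, A i (s i) (t i)

/-- Density operators. -/
def IsState {κ : Type} [Fintype κ] (ρ : Matrix κ κ ℂ) : Prop :=
  ρ.PosSemidef ∧ ρ.trace = 1

/-- Normalized state vectors. -/
def IsUnitVec {κ : Type} [Fintype κ] (ψ : κ → ℂ) : Prop :=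
  star ψ ⬝ᵥ ψ = 1

/-- The energy `⟨ψ|H|ψ⟩`. -/
def energy {κ : Type} [Fintype κ] (H : Matrix κ κ ℂ) (ψ : κ → ℂ) : ℝ :=
  (star ψ ⬝ᵥ (H *ᵥ ψ)).re

/-- `ψ` is a ground state of `H`: a normalized vector of least energy. -/
def IsGroundState {κ : Type} [Fintype κ] (H : Matrix κ κ ℂ) (ψ : κ → ℂ) : Prop :=
  IsUnitVec ψ ∧ ∀ φ, IsUnitVec φ → energy H ψ ≤ energy H φ

/-- The density operator `|ψ⟩⟨ψ|`. -/
def pureState {κ : Type} (ψ : κ → ℂ) : Matrix κ κ ℂ := Matrix.vecMulVec ψ (star ψ)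

/-! ## XZ-Hamiltonians -/

/-- An XZ-Hamiltonian `∑ i, aᵢ Sᵢ` on `n` qubits: each `Sᵢ` is a tensor product of factors
`I`, `X`, `Z` with at most one factor `X` and at most one factor `Z`. -/
structure XZHamiltonian (n : ℕ) where
  /-- the number of terms -/
  numTerms : ℕ
  /-- the real coefficients `aᵢ` -/
  coeff : Fin numTerms → ℝ
  /-- the factors of the terms `Sᵢ` -/
  term : Fin numTerms → Fin n → XZ
  weightX_le : ∀ i, (Finset.univ.filter fun j => term i j = XZ.X).card ≤ 1
  weightZ_le : ∀ i, (Finset.univ.filter fun j => term i j = XZ.Z).card ≤ 1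

/-- The operator `H = ∑ i, aᵢ Sᵢ`. -/
def XZHamiltonian.op {n : ℕ} (H : XZHamiltonian n) : Op (Fin n) :=
  ∑ i, (H.coeff i : ℂ) • tensorOp fun j => pauli (H.term i j)

/-- The normalization `∑ i, |aᵢ|`. -/
def XZHamiltonian.norm1 {n : ℕ} (H : XZHamiltonian n) : ℝ := ∑ i, |H.coeff i|

/-! ## CSS codes encoding one qubit, and their concatenation -/

/-- The dual of a binary linear code. -/
def dualCode {m : ℕ} (C : Submodule (ZMod 2) (Fin m → ZMod 2)) :
    Submodule (ZMod 2) (Fin m → ZMod 2) where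
  carrier := {v | ∀ u ∈ C, u ⬝ᵥ v = 0}
  add_mem' := by
    intro v w hv hw u hu
    rw [dotProduct_add, hv u hu, hw u hu, add_zero]
  zero_mem' := by
    intro u _
    exact dotProduct_zero u
  smul_mem' := by
    intro c v hv u hu
    rw [dotProduct_smul, hv u hu, smul_zero]

/-- A CSS code on `m` qubits, built from binary linear codes `C₂ ⊆ C₁` with
`dim C₁ = dim C₂ + 1`, so that it encodes one qubit. The stabilizers are the products of `X`
along words of `C₂` and the products of `Z` along words of the dual of `C₁`. The logical
operators are the products of `X` along `lX` and of `Z` along `lZ`; when both words are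
all-ones, these are `X ⊗ ⋯ ⊗ X` and `Z ⊗ ⋯ ⊗ Z`. -/
structure CSSCode (m : ℕ) where
  C₁ : Submodule (ZMod 2) (Fin m → ZMod 2)
  C₂ : Submodule (ZMod 2) (Fin m → ZMod 2)
  le : C₂ ≤ C₁
  finrank_eq : Module.finrank (ZMod 2) C₁ = Module.finrank (ZMod 2) C₂ + 1
  lX : Fin m → ZMod 2
  lZ : Fin m → ZMod 2
  lX_mem : lX ∈ C₁
  lZ_mem : lZ ∈ dualCode C₂
  lX_dot_lZ : lX ⬝ᵥ lZ = 1

/-- The physical qubits of a block of a code on `m` qubits concatenated `k` times: there are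
`m ^ k` of them. The first coordinate is the outermost level. -/
abbrev Block (m k : ℕ) : Type := Fin k → Fin m

open Classical in
/-- The encoding isometry of one level, whose columns are the code states
`|b̃⟩ = |C₂|^{-1/2} ∑_{v ∈ C₂} |v + b lX⟩`. -/
def CSSCode.enc {m : ℕ} (Q : CSSCode m) : Matrix (Reg (Fin m)) (ZMod 2) ℂ :=
  Matrix.of fun s b => if s - b • Q.lX ∈ Q.C₂ then ((Real.sqrt (Nat.card Q.C₂))⁻¹ : ℂ) else 0

/-- The encoding isometry of `k` levels of concatenation: encode into `m` qubits, then encode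
each of them with the remaining levels. -/
def CSSCode.concatEnc {m : ℕ} (Q : CSSCode m) : (k : ℕ) → Matrix (Reg (Block m k)) (ZMod 2) ℂ
  | 0 => Matrix.of fun s b => if s Fin.elim0 = b then 1 else 0
  | k + 1 => Matrix.of fun s b =>
      ∑ y : Reg (Fin m), (∏ j, Q.concatEnc k (fun q => s (Fin.cons j q)) (y j)) * Q.enc y b

/-- The encoding isometry applied to each of `n` qubits. -/
def CSSCode.encReg {m : ℕ} (Q : CSSCode m) (n k : ℕ) :
    Matrix (Reg (Fin n × Block m k)) (Reg (Fin n)) ℂ :=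
  Matrix.of fun s x => ∏ i, Q.concatEnc k (fun q => s (i, q)) (x i)

/-- The encoded version of an `n`-qubit density operator. -/
def CSSCode.encState {m : ℕ} (Q : CSSCode m) {n : ℕ} (k : ℕ) (ρ : Op (Fin n)) :
    Op (Fin n × Block m k) :=
  Q.encReg n k * ρ * (Q.encReg n k)ᴴ

/-- The factor at the physical qubit `q` of the logical `I`, `X` or `Z` of the code
concatenated `k` times. -/
def CSSCode.logical {m : ℕ} (Q : CSSCode m) (k : ℕ) : XZ → Block m k → XZ
  | XZ.I, _ => XZ.I
  | XZ.X, q => if ∏ l, Q.lX (q l) = 1 then XZ.X else XZ.I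
  | XZ.Z, q => if ∏ l, Q.lZ (q l) = 1 then XZ.Z else XZ.I

/-- The encoded Hamiltonian `∑ i, aᵢ S̃ᵢ`: in every term, each `I`, `X`, `Z` is replaced by its
logical counterpart. -/
def CSSCode.encHam {m : ℕ} (Q : CSSCode m) {n : ℕ} (k : ℕ) (H : XZHamiltonian n) :
    Op (Fin n × Block m k) :=
  ∑ i, (H.coeff i : ℂ) • tensorOp fun p => pauli (Q.logical k (H.term i p.1) p.2)

/-- The operator `H ⊗ I`, where in every block `H` acts on the qubit `q₀`. -/
def XZHamiltonian.opTensorId {n : ℕ} (H : XZHamiltonian n) {β : Type} [Fintype β]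
    [DecidableEq β] (q₀ : β) : Op (Fin n × β) :=
  ∑ i, (H.coeff i : ℂ) • tensorOp fun p => if p.2 = q₀ then pauli (H.term i p.1) else 1

/-- The `n`-fold tensor power of an operator on a block. -/
def blockPow {β : Type} [Fintype β] (n : ℕ) (E : Op β) : Op (Fin n × β) :=
  Matrix.of fun s t => ∏ i, E (fun q => s (i, q)) (fun q => t (i, q))

open Classical in
/-- The vector `|ψ⟩|0⋯0⟩`: the qubits of `ψ` are the qubits `q₀` of the blocks, the other
qubits of the blocks are ancillas in state `|0⟩`. -/
def withAncilla {n : ℕ} {β : Type} (q₀ : β) (ψ : Reg (Fin n) → ℂ) : Reg (Fin n × β) → ℂ :=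
  fun s => if ∀ i q, q ≠ q₀ → s (i, q) = 0 then ψ (fun i => s (i, q₀)) else 0

/-! ## Classical post-processing -/

/-- A syndrome decoder of a binary linear code `C`: the syndrome of a received word is its
class modulo `C`, and to every syndrome the decoder assigns an error with that syndrome. -/
structure SyndromeDecoder {m : ℕ} (C : Submodule (ZMod 2) (Fin m → ZMod 2)) where
  /-- the error presumed for a given syndrome -/
  corr : ((Fin m → ZMod 2) ⧸ C) → (Fin m → ZMod 2)
  mk_corr : ∀ s, Submodule.Quotient.mk (corr s) = s

/-- The decoded bit: correct the received word, then take its parity along `l`. -/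
def SyndromeDecoder.bit {m : ℕ} {C : Submodule (ZMod 2) (Fin m → ZMod 2)}
    (D : SyndromeDecoder C) (l z : Fin m → ZMod 2) : ZMod 2 :=
  l ⬝ᵥ (z - D.corr (Submodule.Quotient.mk z))

/-- The classical decoders of a CSS code. The outcomes of a transversal `Z` measurement of a
code state are words of `C₁`, those of a transversal `X` measurement are words of the dual of
`C₂`. -/
structure CSSCode.Decoder {m : ℕ} (Q : CSSCode m) where
  decX : SyndromeDecoder (dualCode Q.C₂)
  decZ : SyndromeDecoder Q.C₁

/-- The decoders correct every error on at most one qubit of the block. -/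
def CSSCode.Decoder.CorrectsSingleErrors {m : ℕ} {Q : CSSCode m} (D : Q.Decoder) : Prop :=
  ∀ e : Fin m → ZMod 2, hammingNorm e ≤ 1 →
    D.decX.bit Q.lX e = 0 ∧ D.decZ.bit Q.lZ e = 0

/-- Level-by-level decoding of the outcomes of a concatenated block. -/
def concatDecode {m : ℕ} (d : (Fin m → ZMod 2) → ZMod 2) : (k : ℕ) → Reg (Block m k) → ZMod 2
  | 0, s => s Fin.elim0
  | k + 1, s => d fun j => concatDecode d k fun q => s (Fin.cons j q)

/-- The decoded outcome of a block measured in the basis `P`; a block that is not measured is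
recorded as `0`. -/
def CSSCode.Decoder.decode {m : ℕ} {Q : CSSCode m} (D : Q.Decoder) (k : ℕ) :
    XZ → Reg (Block m k) → ZMod 2
  | XZ.I, _ => 0
  | XZ.X, s => concatDecode (D.decX.bit Q.lX) k s
  | XZ.Z, s => concatDecode (D.decZ.bit Q.lZ) k s

/-! ## Single-qubit measurements and noise -/

/-- The ideal single-qubit measurement operators: `effect Z v = |v⟩⟨v|` and `effect X v` is the
projector onto the eigenvector of `X` for the eigenvalue `(-1)^v`. A qubit that is not measured
(`I`) is recorded as `0`. -/
def effect : XZ → ZMod 2 → QubitOp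
  | XZ.I, v => if v = 0 then 1 else 0
  | XZ.X, v => (1 / 2 : ℂ) • (1 + (if v = 0 then (1 : ℂ) else -1) • pauli XZ.X)
  | XZ.Z, v => (1 / 2 : ℂ) • (1 + (if v = 0 then (1 : ℂ) else -1) • pauli XZ.Z)

/-- The probability of the outcome string `s` when each qubit `i` of a register in state `ρ` is
measured individually in the basis `P i`. -/
def outcomeProb {ι : Type} [Fintype ι] [DecidableEq ι] (P : ι → XZ) (ρ : Op ι) (s : Reg ι) : ℝ :=
  (tensorOp (fun i => effect (P i) (s i)) * ρ).trace.re

/-- The family `K` of single-qubit Kraus operators defines a channel. -/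
def IsKraus {κ : Type} [Fintype κ] (K : κ → QubitOp) : Prop :=
  ∑ j, (K j)ᴴ * K j = 1

/-- The tensor power of the single-qubit channel with Kraus operators `K`, acting on a
register. -/
def iidChannel {κ ι : Type} [Fintype κ] [Fintype ι] [DecidableEq ι] (K : κ → QubitOp)
    (ρ : Op ι) : Op ι :=
  ∑ f : ι → κ, tensorOp (fun i => K (f i)) * ρ * (tensorOp (fun i => K (f i)))ᴴ

/-- Kraus operators of the noise of the measurement device on one qubit: with probability
`1 - ε` nothing happens, with probability `ε` the channel with Kraus operators `K` acts. -/
def noiseKraus {r : ℕ} (ε : ℝ) (K : Fin r → QubitOp) : Option (Fin r) → QubitOp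
  | none => (Real.sqrt (1 - ε) : ℂ) • (1 : QubitOp)
  | some j => (Real.sqrt ε : ℂ) • K j

/-- Independent identically distributed noise on all qubits of a register, preceding an ideal
measurement. -/
def noise {r : ℕ} {ι : Type} [Fintype ι] [DecidableEq ι] (ε : ℝ) (K : Fin r → QubitOp)
    (ρ : Op ι) : Op ι :=
  iidChannel (noiseKraus ε K) ρ

/-- The probability that, when the blocks of a physical register in state `σ` are measured
transversally in the bases `P` and decoded, the decoded outcomes are `y`. -/
def CSSCode.Decoder.decodedProb {m : ℕ} {Q : CSSCode m} (D : Q.Decoder) {n k : ℕ}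
    (P : Fin n → XZ) (σ : Op (Fin n × Block m k)) (y : Reg (Fin n)) : ℝ :=
  ∑ s : Reg (Fin n × Block m k),
    if (fun i => D.decode k (P i) fun q => s (i, q)) = y
      then outcomeProb (fun p => P p.1) σ s else 0

/-! ## The post hoc protocol and its fault tolerant version -/

/-- The measured value `±1` of a term, from the outcomes of its factors. -/
def outcomeSign {n : ℕ} (y : Reg (Fin n)) : ℝ := ∏ i, if y i = 0 then 1 else -1

/-- The verifier's acceptance probability, when the outcomes of the measurement of the factors
of a term `P` are distributed according to `pr P`: choose the term `i` with probability
`|aᵢ| / ∑ |aⱼ|`, measure it, accept if its value is `-sgn aᵢ`. -/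
def XZHamiltonian.acceptProb {n : ℕ} (H : XZHamiltonian n)
    (pr : (Fin n → XZ) → Reg (Fin n) → ℝ) : ℝ :=
  ∑ i, |H.coeff i| / H.norm1 *
    ∑ y : Reg (Fin n), if outcomeSign y = -Real.sign (H.coeff i) then pr (H.term i) y else 0

/-- Acceptance probability of the original protocol with ideal devices, when the prover sends
the `n`-qubit state `ρ`. -/
def XZHamiltonian.postHocAccept {n : ℕ} (H : XZHamiltonian n) (ρ : Op (Fin n)) : ℝ :=
  H.acceptProb fun P => outcomeProb P ρ

/-- Acceptance probability of the fault tolerant protocol with `k` levels of concatenation and a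
noisy measurement device, when the prover sends the state `σ` of the physical qubits. -/
def CSSCode.Decoder.ftAccept {m : ℕ} {Q : CSSCode m} (D : Q.Decoder) {n k r : ℕ}
    (H : XZHamiltonian n) (ε : ℝ) (K : Fin r → QubitOp) (σ : Op (Fin n × Block m k)) : ℝ :=
  H.acceptProb fun P => D.decodedProb P (noise ε K σ)

/-! ## History states and the Morimae–Fitzsimons scheme of a language -/

/-- The state of a circuit after its first `t` gates. -/
def circuitState {w T : ℕ} (U : Fin T → Matrix.unitaryGroup (Reg (Fin w)) ℂ) (x : Reg (Fin w)) :
    ℕ → Reg (Fin w) → ℂ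
  | 0 => Pi.single x 1
  | t + 1 => if h : t < T then (U ⟨t, h⟩ : Op (Fin w)) *ᵥ circuitState U x t
      else circuitState U x t

/-- The Feynman–Kitaev state `(T+1)^{-1/2} ∑ t, U_t ⋯ U_1 |x⟩ |1^t 0^{T-t}⟩`. -/
def historyState {w T : ℕ} (U : Fin T → Matrix.unitaryGroup (Reg (Fin w)) ℂ) (x : Reg (Fin w)) :
    Reg (Fin (w + T)) → ℂ :=
  fun s => ((Real.sqrt (T + 1))⁻¹ : ℂ) * ∑ t ∈ Finset.range (T + 1),
    circuitState U x t (fun i => s (Fin.castAdd T i)) *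
      if ∀ j : Fin T, s (Fin.natAdd w j) = if (j : ℕ) < t then 1 else 0 then 1 else 0

/-- The data of a post hoc scheme: for every input `x`, a quantum circuit with its initial basis
state, an XZ-Hamiltonian on the qubits of its history state, and two thresholds. -/
structure PostHocScheme where
  width : List Bool → ℕ
  depth : List Bool → ℕ
  gates : ∀ x, Fin (depth x) → Matrix.unitaryGroup (Reg (Fin (width x))) ℂ
  input : ∀ x, Reg (Fin (width x))
  ham : ∀ x, XZHamiltonian (width x + depth x)
  a : List Bool → ℝ
  b : List Bool → ℝ

/-- The state that the honest prover prepares and encodes. -/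
def PostHocScheme.witness (S : PostHocScheme) (x : List Bool) :
    Reg (Fin (S.width x + S.depth x)) → ℂ :=
  historyState (S.gates x) (S.input x)

/-- The scheme is a post hoc scheme for the language `L`: on yes-instances the history state has
energy at most `b`, on no-instances every state has energy at least `a`. -/
def PostHocScheme.IsFor (S : PostHocScheme) (L : Set (List Bool)) : Prop :=
  (∀ x ∈ L, energy (S.ham x).op (S.witness x) ≤ S.b x) ∧
  (∀ x ∉ L, ∀ φ, IsUnitVec φ → S.a x ≤ energy (S.ham x).op φ)

/-- The promise gap `a - b` is positive and at least inverse polynomial in the length of the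
input (degree `d`), and `∑ |aᵢ|` is non-zero and at most polynomial (degree `e`). -/
def HasPromiseGap {n : ℕ} (H : XZHamiltonian n) (a b : ℝ) (d e N : ℕ) : Prop :=
  0 < H.norm1 ∧ H.norm1 ≤ ((N : ℝ) + 2) ^ e ∧ 1 / ((N : ℝ) + 2) ^ d ≤ a - b

end

/-!
# Fault tolerant post hoc verification with measurement noise below a threshold

Operators of decoded measurements are written as `decodedEffect g f v`: the sum, over the strings
`s` that the decoder `g` maps to `v`, of the products of the single-qubit effects `f (s q)`.
A decoded outcome of a register of blocks is the tensor product of such operators, and a block of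
`k + 1` levels is a register of `m` blocks of `k` levels (`decodedEffect_blocks`). All arguments
about concatenation are inductions along this decomposition.

*The encoded Hamiltonian.* The logical `X` and `Z` of a block are anticommuting Pauli strings, so
the block is a sum of copies of one qubit on which they act as the Pauli operators
(`exists_kraus_of_anticomm`), and the encoded Hamiltonian is a sum of copies of `H`
(`exists_copies_encHam`). This gives the spectrum and the energy bounds. The unitary `E` comes from
an orthonormal basis of the space `Z̃ = 1` that contains the code state `|0̃⟩`
(`exists_unitary_encoding`).

*Soundness.* The observables decoded from `X` and from `Z` measurements of a block anticommute even
away from the code space (`decodedObs_anticomm`): shifts by words of `lX + C₂` preserve the `Z`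
syndrome and flip the decoded `Z` bit. Hence a single channel extracts a qubit from the block such
that decoded measurements of the block, in either basis, are measurements of the qubit
(`exists_kraus_decodedEffect`), and any physical state has the decoded statistics of some `n`-qubit
state (`exists_logical_state`). Since noise maps states to states, it cannot raise the
acceptance probability above the maximum of the ideal protocol.

*Completeness.* On code states the syndrome of a transversal measurement is trivial
(`effect_mul_enc_eq_zero`), so a fault in a single sub-block does not change the decoded outcome
(`sum_piTensor_mul_enc_of_single_fault`), whatever operators describe the fault. Expanding the noisy
effects over the sets of faulty sub-blocks, the decoded noisy effects are the sum of a part of weight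
`1 - q` that acts on code states as the ideal effects do, and a positive part of weight `q`, where
one level replaces `q` by the probability that two of `m` sub-blocks are faulty, at most `m² q²`
(`exists_faultSplitting`). So `α = m²`, and the weight after `k` levels is at most
`α ^ (2 ^ k - 1) ε ^ (2 ^ k)`. The tensor product over the blocks gives the bound of the total
variation distance, and a term of an XZ-Hamiltonian measures at most two blocks.

The acceptance probability of the ideal protocol is `(1 - tr (H ρ) / ‖a‖₁) / 2`
(`postHocAccept_eq`), and `2 ^ k` has to grow only as `log (1 / η)` (`exists_levels`).
-/

/-! ### Tensor products of families of matrices -/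

section Tensor

variable {ι R C S κ : Type} [Fintype ι]

/-- The tensor product `⨂ i, A i` of rectangular matrices, its rows and columns being indexed by
families of indices. -/
def piTensor (A : ι → Matrix R C ℂ) : Matrix (ι → R) (ι → C) ℂ :=
  Matrix.of fun s t => ∏ i, A i (s i) (t i)

lemma piTensor_apply (A : ι → Matrix R C ℂ) (s : ι → R) (t : ι → C) :
    piTensor A s t = ∏ i, A i (s i) (t i) := rfl

lemma tensorOp_eq_piTensor (A : ι → QubitOp) : tensorOp A = piTensor A := rfl

lemma piTensor_mul [DecidableEq ι] [Fintype C] (A : ι → Matrix R C ℂ) (B : ι → Matrix C S ℂ) :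
    piTensor A * piTensor B = piTensor fun i => A i * B i := by
  ext s t
  simp only [Matrix.mul_apply, piTensor_apply, Finset.prod_univ_sum, Fintype.piFinset_univ,
    Finset.prod_mul_distrib]

lemma piTensor_conjTranspose (A : ι → Matrix R C ℂ) :
    (piTensor A)ᴴ = piTensor fun i => (A i)ᴴ := by
  ext s t
  simp [piTensor_apply, Matrix.conjTranspose_apply]

lemma piTensor_one [DecidableEq ι] [DecidableEq R] :
    piTensor (fun _ : ι => (1 : Matrix R R ℂ)) = 1 := by
  ext s t
  simp only [piTensor_apply, Matrix.one_apply, Finset.prod_ite_zero, funext_iff]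
  simp

lemma piTensor_smul (c : ι → ℂ) (A : ι → Matrix R C ℂ) :
    piTensor (fun i => c i • A i) = (∏ i, c i) • piTensor A := by
  ext s t
  simp [piTensor_apply, Finset.prod_mul_distrib]

lemma piTensor_eq_zero {A : ι → Matrix R C ℂ} {i : ι} (h : A i = 0) : piTensor A = 0 := by
  ext s t
  exact Finset.prod_eq_zero (Finset.mem_univ i) (by simp [h])

lemma piTensor_sum [DecidableEq ι] [Fintype κ] (A : ι → κ → Matrix R C ℂ) :
    piTensor (fun i => ∑ a, A i a) = ∑ f : ι → κ, piTensor fun i => A i (f i) := by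
  ext s t
  simp only [Matrix.sum_apply, piTensor_apply, Finset.prod_univ_sum, Fintype.piFinset_univ]

lemma piTensor_add [DecidableEq ι] (A B : ι → Matrix R C ℂ) :
    piTensor (fun i => A i + B i) =
      ∑ T : Finset ι, piTensor fun i => if i ∈ T then A i else B i := by
  ext s t
  simp only [Matrix.sum_apply, piTensor_apply, Matrix.add_apply, Finset.prod_add,
    Finset.powerset_univ]
  refine Finset.sum_congr rfl fun T _ => ?_
  rw [← Finset.prod_sdiff (Finset.subset_univ T), mul_comm]
  congr 1
  · exact Finset.prod_congr rfl fun i hi => by simp [(Finset.mem_sdiff.1 hi).2]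
  · exact Finset.prod_congr rfl fun i hi => by simp [hi]

open scoped MatrixOrder in
lemma Matrix.PosSemidef.exists_eq_conjTranspose_mul_self [Fintype R] [DecidableEq R]
    {A : Matrix R R ℂ} (hA : A.PosSemidef) : ∃ B : Matrix R R ℂ, A = Bᴴ * B :=
  CStarAlgebra.nonneg_iff_eq_star_mul_self.mp hA.nonneg

lemma piTensor_posSemidef [DecidableEq ι] [Fintype R] [DecidableEq R] {A : ι → Matrix R R ℂ}
    (hA : ∀ i, (A i).PosSemidef) : (piTensor A).PosSemidef := by
  choose B hB using fun i => (hA i).exists_eq_conjTranspose_mul_self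
  have : piTensor A = (piTensor B)ᴴ * piTensor B := by
    rw [piTensor_conjTranspose, piTensor_mul]
    exact congrArg piTensor (funext hB)
  rw [this]
  exact posSemidef_conjTranspose_mul_self _

lemma Matrix.PosSemidef.trace_mul_nonneg [Fintype R] [DecidableEq R]
    {A B : Matrix R R ℂ} (hA : A.PosSemidef) (hB : B.PosSemidef) : 0 ≤ (A * B).trace := by
  obtain ⟨C, rfl⟩ := hA.exists_eq_conjTranspose_mul_self
  rw [Matrix.mul_assoc, Matrix.trace_mul_comm]
  exact (hB.mul_mul_conjTranspose_same C).trace_nonneg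

lemma Matrix.PosSemidef.trace_mul_re_nonneg [Fintype R] [DecidableEq R]
    {A B : Matrix R R ℂ} (hA : A.PosSemidef) (hB : B.PosSemidef) : 0 ≤ (A * B).trace.re :=
  (Complex.le_def.1 (hA.trace_mul_nonneg hB)).1

end Tensor

/-! ### Registers made of blocks -/

section Blocks

variable {ι β γ : Type}

/-- A register whose qubits are arranged in blocks by `e`: a string is a family of strings of
the blocks. -/
def regEquiv (e : ι × β ≃ γ) : Reg γ ≃ (ι → Reg β) where
  toFun s i q := s (e (i, q))
  invFun y p := y (e.symm p).1 (e.symm p).2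
  left_inv s := by ext p; simp
  right_inv y := by ext i q; simp

lemma regEquiv_apply (e : ι × β ≃ γ) (s : Reg γ) (i : ι) (q : β) :
    regEquiv e s i q = s (e (i, q)) := rfl

lemma tensorOp_eq_submatrix [Fintype ι] [Fintype β] [Fintype γ] (e : ι × β ≃ γ) (A : γ → QubitOp) :
    tensorOp A = (piTensor fun i => tensorOp fun q => A (e (i, q))).submatrix
      (regEquiv e) (regEquiv e) := by
  ext s t
  simp only [tensorOp, piTensor_apply, Matrix.submatrix_apply, Matrix.of_apply, regEquiv_apply]
  rw [← Equiv.prod_comp e, Fintype.prod_prod_type]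

lemma submatrix_mul_left {R S T U : Type} [Fintype S] (f : U → R)
    (A : Matrix R S ℂ) (B : Matrix S T ℂ) :
    A.submatrix f id * B = (A * B).submatrix f id := by
  ext i j
  simp [Matrix.mul_apply]

end Blocks

section TensorOp

variable {ι : Type} [Fintype ι]

lemma tensorOp_mul [DecidableEq ι] (A B : ι → QubitOp) :
    tensorOp A * tensorOp B = tensorOp fun i => A i * B i := piTensor_mul A B

lemma tensorOp_conjTranspose (A : ι → QubitOp) :
    (tensorOp A)ᴴ = tensorOp fun i => (A i)ᴴ := piTensor_conjTranspose A

lemma tensorOp_one [DecidableEq ι] : tensorOp (fun _ : ι => (1 : QubitOp)) = 1 := piTensor_one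

end TensorOp

/-! ### Operators of decoded measurements -/

/-- The operator of the event that the outcomes `s` of measurements of the qubits of a register
satisfy `g s = v`, when `f` are the (possibly noisy) effects of the measurement of one qubit. -/
noncomputable def decodedEffect {β : Type} [Fintype β] [DecidableEq β] (g : Reg β → ZMod 2)
    (f : ZMod 2 → QubitOp) (v : ZMod 2) : Op β :=
  ∑ s, if g s = v then tensorOp (fun q => f (s q)) else 0

section DecodedEffect

variable {β : Type} [Fintype β] [DecidableEq β]

lemma sum_decodedEffect (g : Reg β → ZMod 2) {f : ZMod 2 → QubitOp} (hf : ∑ v, f v = 1) :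
    ∑ v, decodedEffect g f v = 1 := by
  have h := piTensor_sum (fun (_ : β) => f)
  simp only [hf, piTensor_one] at h
  simp only [decodedEffect]
  rw [Finset.sum_comm, h]
  refine Finset.sum_congr rfl fun s _ => ?_
  simp [tensorOp_eq_piTensor]

lemma decodedEffect_zero {f : ZMod 2 → QubitOp} (hf : ∑ v, f v = 1) (v : ZMod 2) :
    decodedEffect (fun _ : Reg β => 0) f v = if v = 0 then 1 else 0 := by
  have h := piTensor_sum (fun (_ : β) => f)
  simp only [hf, piTensor_one] at h
  simp only [decodedEffect, eq_comm (a := (0 : ZMod 2)), tensorOp_eq_piTensor]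
  split_ifs
  · rw [h]
  · simp

lemma piTensor_decodedEffect {ι : Type} [Fintype ι] [DecidableEq ι] (g : ι → Reg β → ZMod 2)
    (f : ι → ZMod 2 → QubitOp) (y : Reg ι) :
    piTensor (fun i => decodedEffect (g i) (f i) (y i)) =
      ∑ s : ι → Reg β, if (fun i => g i (s i)) = y then
        piTensor (fun i => tensorOp fun q => f i (s i q)) else 0 := by
  simp only [decodedEffect, piTensor_sum]
  refine Finset.sum_congr rfl fun s _ => ?_
  split_ifs with h
  · congr 1; ext1 i; rw [if_pos (congrFun h i)]
  · obtain ⟨i, hi⟩ := Function.ne_iff.1 h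
    exact piTensor_eq_zero (i := i) (if_neg hi)

/-- Decoding block by block, then decoding the outcomes of the blocks. -/
lemma decodedEffect_blocks {ι γ : Type} [Fintype ι] [DecidableEq ι] [Fintype γ] [DecidableEq γ]
    (e : ι × β ≃ γ) (d : Reg ι → ZMod 2) (g : Reg β → ZMod 2) (f : ZMod 2 → QubitOp)
    (v : ZMod 2) :
    decodedEffect (fun s => d fun i => g (regEquiv e s i)) f v =
      (∑ y, if d y = v then piTensor (fun i => decodedEffect g f (y i)) else 0).submatrix
        (regEquiv e) (regEquiv e) := by
  have h2 : (∑ y, if d y = v then piTensor (fun i => decodedEffect g f (y i)) else 0) =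
      ∑ s : ι → Reg β, if (d fun i => g (s i)) = v then
        piTensor (fun i => tensorOp fun q => f (s i q)) else 0 := by
    have h3 : ∀ y : Reg ι,
        (if d y = v then piTensor (fun i => decodedEffect g f (y i)) else 0) =
          ∑ s : ι → Reg β, if (fun i => g (s i)) = y then (if d y = v then
            piTensor (fun i => tensorOp fun q => f (s i q)) else 0) else 0 := by
      intro y
      split_ifs
      · exact piTensor_decodedEffect (fun _ => g) (fun _ => f) y
      · simp
    simp only [h3]
    rw [Finset.sum_comm]
    simp
  rw [h2]
  ext s t
  simp only [decodedEffect, Matrix.submatrix_apply, Matrix.sum_apply]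
  rw [← Equiv.sum_comp (regEquiv e)]
  refine Finset.sum_congr rfl fun u _ => ?_
  split_ifs
  · rw [tensorOp_eq_submatrix e]; rfl
  · rfl

end DecodedEffect

/-! ### Signs, Pauli strings and measurement projectors -/

/-- The sign `(-1)^v`. -/
def sgn (v : ZMod 2) : ℂ := if v = 0 then 1 else -1

@[simp] lemma sgn_zero : sgn 0 = 1 := rfl

@[simp] lemma sgn_one : sgn 1 = -1 := rfl

lemma zmod_two_cases (v : ZMod 2) : v = 0 ∨ v = 1 := by
  revert v; decide

lemma sgn_add (v w : ZMod 2) : sgn (v + w) = sgn v * sgn w := by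
  rcases zmod_two_cases v with rfl | rfl <;> rcases zmod_two_cases w with rfl | rfl <;>
    simp [CharTwo.add_self_eq_zero]

lemma sgn_mul_self (v : ZMod 2) : sgn v * sgn v = 1 := by
  rcases zmod_two_cases v with rfl | rfl <;> simp

lemma sgn_add_one (v : ZMod 2) : sgn (v + 1) = -sgn v := by simp [sgn_add]

lemma star_sgn (v : ZMod 2) : star (sgn v) = sgn v := by
  rcases zmod_two_cases v with rfl | rfl <;> simp

lemma sgn_sum {ι : Type} (s : Finset ι) (f : ι → ZMod 2) :
    sgn (∑ i ∈ s, f i) = ∏ i ∈ s, sgn (f i) := by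
  classical
  induction s using Finset.induction with
  | empty => simp
  | insert a s ha ih => rw [Finset.sum_insert ha, Finset.prod_insert ha, sgn_add, ih]

lemma sgn_dotProduct {ι : Type} [Fintype ι] (u v : ι → ZMod 2) :
    sgn (u ⬝ᵥ v) = ∏ i, sgn (u i * v i) := sgn_sum _ _

lemma sum_zmod_two {M : Type} [AddCommMonoid M] (f : ZMod 2 → M) : ∑ v, f v = f 0 + f 1 :=
  Fin.sum_univ_two f

lemma pauli_X_apply (s t : ZMod 2) : pauli XZ.X s t = if s = t + 1 then 1 else 0 := by
  rcases zmod_two_cases s with rfl | rfl <;> rcases zmod_two_cases t with rfl | rfl <;>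
    simp [pauli, CharTwo.add_self_eq_zero]

lemma pauli_Z_apply (s t : ZMod 2) : pauli XZ.Z s t = if s = t then sgn s else 0 := by
  simp [pauli, Matrix.diagonal_apply, sgn]

lemma pauli_isHermitian (P : XZ) : (pauli P)ᴴ = pauli P := by
  cases P
  · simp [pauli]
  · ext s t
    simp only [Matrix.conjTranspose_apply, pauli, Matrix.of_apply, eq_comm (a := t)]
    split_ifs <;> simp
  · ext s t
    simp only [Matrix.conjTranspose_apply, pauli_Z_apply, eq_comm (a := t)]
    split_ifs with h
    · rw [h, star_sgn]
    · simp

lemma pauli_mul_self (P : XZ) : pauli P * pauli P = 1 := by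
  cases P
  · simp [pauli]
  · ext s t
    rcases zmod_two_cases s with rfl | rfl <;> rcases zmod_two_cases t with rfl | rfl <;>
      simp [pauli, Matrix.mul_apply, sum_zmod_two]
  · ext s t
    rcases zmod_two_cases s with rfl | rfl <;> rcases zmod_two_cases t with rfl | rfl <;>
      simp [pauli, Matrix.mul_apply, sum_zmod_two]

lemma effect_eq {P : XZ} (hP : P ≠ XZ.I) (v : ZMod 2) :
    effect P v = (1 / 2 : ℂ) • (1 + sgn v • pauli P) := by
  cases P
  · exact absurd rfl hP
  · rfl
  · rfl

lemma sum_effect (P : XZ) : ∑ v, effect P v = 1 := by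
  rw [sum_zmod_two]
  cases P
  · simp [effect]
  all_goals
    rw [effect_eq (by simp), effect_eq (by simp), ← smul_add, sgn_zero, sgn_one, neg_smul]
    rw [add_add_add_comm, add_neg_cancel, add_zero, ← two_smul ℂ, smul_smul]
    norm_num

lemma effect_isHermitian (P : XZ) (v : ZMod 2) : (effect P v)ᴴ = effect P v := by
  by_cases hP : P = XZ.I
  · subst hP
    simp only [effect]
    split_ifs <;> simp
  · rw [effect_eq hP]
    simp [pauli_isHermitian, star_sgn]

lemma effect_mul_self (P : XZ) (v : ZMod 2) : effect P v * effect P v = effect P v := by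
  by_cases hP : P = XZ.I
  · subst hP
    simp only [effect]
    split_ifs <;> simp
  · rw [effect_eq hP]
    simp only [smul_mul_assoc, mul_smul_comm, add_mul, mul_add, one_mul, mul_one, pauli_mul_self,
      smul_add]
    rcases zmod_two_cases v with rfl | rfl <;> simp only [sgn_zero, sgn_one] <;> module

lemma effect_mul_of_ne (P : XZ) {v w : ZMod 2} (h : v ≠ w) : effect P v * effect P w = 0 := by
  have hw : effect P v + effect P w = 1 := by
    rw [← sum_effect P, sum_zmod_two]
    rcases zmod_two_cases v with rfl | rfl <;> rcases zmod_two_cases w with rfl | rfl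
    · exact absurd rfl h
    · rfl
    · exact add_comm _ _
    · exact absurd rfl h
  rw [eq_sub_of_add_eq' hw, mul_sub, effect_mul_self, mul_one, sub_self]

lemma effect_posSemidef (P : XZ) (v : ZMod 2) : (effect P v).PosSemidef := by
  have := posSemidef_conjTranspose_mul_self (effect P v)
  rwa [effect_isHermitian, effect_mul_self] at this

/-- Weighting the outcomes of a measurement with the signs of their parity along `l` gives the
Pauli string along `l`. -/
lemma sum_sgn_smul_tensorOp_effect {ι : Type} [Fintype ι] [DecidableEq ι] {P : XZ} (hP : P ≠ XZ.I)
    (l : ι → ZMod 2) :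
    ∑ u : Reg ι, sgn (l ⬝ᵥ u) • tensorOp (fun q => effect P (u q)) =
      tensorOp fun q => pauli (if l q = 1 then P else XZ.I) := by
  have h : ∀ q, pauli (if l q = 1 then P else XZ.I) = ∑ v, sgn (l q * v) • effect P v := by
    intro q
    rcases zmod_two_cases (l q) with h | h
    · simp [h, sum_effect, pauli]
    · simp only [h, sum_zmod_two, if_true, one_mul, sgn_zero, sgn_one, effect_eq hP]
      module
  simp only [h, tensorOp_eq_piTensor]
  rw [piTensor_sum]
  refine Finset.sum_congr rfl fun u _ => ?_
  rw [piTensor_smul, sgn_dotProduct]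

section PauliStrings

variable {β : Type} [Fintype β]

lemma tensorOp_pauli_X_apply (l : β → ZMod 2) (s t : Reg β) :
    tensorOp (fun q => pauli (if l q = 1 then XZ.X else XZ.I)) s t = if s = t + l then 1 else 0 := by
  have h : ∀ q, pauli (if l q = 1 then XZ.X else XZ.I) (s q) (t q) =
      if s q = t q + l q then 1 else 0 := by
    intro q
    rcases zmod_two_cases (l q) with h | h
    · simp [h, pauli, Matrix.one_apply]
    · simp [h, pauli_X_apply]
  simp only [tensorOp, Matrix.of_apply, h, Finset.prod_ite_zero, funext_iff, Pi.add_apply]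
  simp

lemma tensorOp_pauli_Z_apply (l : β → ZMod 2) (s t : Reg β) :
    tensorOp (fun q => pauli (if l q = 1 then XZ.Z else XZ.I)) s t =
      if s = t then sgn (l ⬝ᵥ s) else 0 := by
  have h : ∀ q, pauli (if l q = 1 then XZ.Z else XZ.I) (s q) (t q) =
      if s q = t q then sgn (l q * s q) else 0 := by
    intro q
    rcases zmod_two_cases (l q) with h | h
    · simp [h, pauli, Matrix.one_apply]
    · simp [h, pauli_Z_apply]
  simp only [tensorOp, Matrix.of_apply, h, Finset.prod_ite_zero, funext_iff, sgn_dotProduct]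
  simp

lemma tensorOp_pauli_isHermitian (P : β → XZ) :
    (tensorOp fun q => pauli (P q))ᴴ = tensorOp fun q => pauli (P q) := by
  simp [tensorOp_conjTranspose, pauli_isHermitian]

lemma tensorOp_pauli_mul_self [DecidableEq β] (P : β → XZ) :
    (tensorOp fun q => pauli (P q)) * (tensorOp fun q => pauli (P q)) = 1 := by
  simp [tensorOp_mul, pauli_mul_self, tensorOp_one]

lemma tensorOp_pauli_anticomm [DecidableEq β] {l l' : β → ZMod 2} (h : l ⬝ᵥ l' = 1) :
    tensorOp (fun q => pauli (if l q = 1 then XZ.X else XZ.I)) *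
        tensorOp (fun q => pauli (if l' q = 1 then XZ.Z else XZ.I)) =
      -(tensorOp (fun q => pauli (if l' q = 1 then XZ.Z else XZ.I)) *
        tensorOp (fun q => pauli (if l q = 1 then XZ.X else XZ.I))) := by
  ext s t
  simp only [Matrix.mul_apply, Matrix.neg_apply, tensorOp_pauli_X_apply, tensorOp_pauli_Z_apply,
    mul_ite, ite_mul, zero_mul, mul_zero, one_mul, mul_one]
  simp only [Finset.sum_ite_eq', Finset.mem_univ, if_true]
  split_ifs with hs
  · rw [hs, dotProduct_add, dotProduct_comm l' l, h, sgn_add_one, neg_neg]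
  · simp

lemma tensorOp_effect_X_apply (u s t : Reg β) :
    tensorOp (fun q => effect XZ.X (u q)) s t =
      (1 / 2 : ℂ) ^ Fintype.card β * sgn (u ⬝ᵥ (s + t)) := by
  have h : ∀ q, effect XZ.X (u q) (s q) (t q) = (1 / 2 : ℂ) * sgn (u q * (s q + t q)) := by
    intro q
    rw [effect_eq (by simp)]
    rcases zmod_two_cases (s q) with h | h <;> rcases zmod_two_cases (t q) with h' | h' <;>
      simp [h, h', pauli, CharTwo.add_self_eq_zero]
  simp only [tensorOp, Matrix.of_apply, h, Finset.prod_mul_distrib, sgn_dotProduct]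
  simp

lemma tensorOp_effect_Z_apply (u s t : Reg β) :
    tensorOp (fun q => effect XZ.Z (u q)) s t = if s = u ∧ t = u then 1 else 0 := by
  have h : ∀ q, effect XZ.Z (u q) (s q) (t q) = if s q = u q ∧ t q = u q then 1 else 0 := by
    intro q
    rw [effect_eq (by simp)]
    rcases zmod_two_cases (u q) with h'' | h'' <;>
    rcases zmod_two_cases (s q) with h | h <;> rcases zmod_two_cases (t q) with h' | h' <;>
      simp [h, h', h'', pauli] <;> norm_num
  simp only [tensorOp, Matrix.of_apply, h, Finset.prod_ite_zero, funext_iff, forall_and]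
  simp

variable [DecidableEq β]

lemma tensorOp_effect_mul (P : XZ) (u u' : Reg β) :
    tensorOp (fun q => effect P (u q)) * tensorOp (fun q => effect P (u' q)) =
      if u = u' then tensorOp (fun q => effect P (u q)) else 0 := by
  rw [tensorOp_mul]
  split_ifs with h
  · subst h; simp [effect_mul_self]
  · obtain ⟨q, hq⟩ := Function.ne_iff.1 h
    exact piTensor_eq_zero (i := q) (effect_mul_of_ne P hq)

lemma sum_tensorOp_effect (P : XZ) :
    ∑ u : Reg β, tensorOp (fun q => effect P (u q)) = 1 := by
  rw [← tensorOp_one, ← sum_effect P]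
  exact (piTensor_sum fun _ => effect P).symm

/-- The `±1`-valued observable of a decoded measurement. -/
noncomputable def decodedObs (g : Reg β → ZMod 2) (P : XZ) : Op β :=
  ∑ u, sgn (g u) • tensorOp (fun q => effect P (u q))

lemma decodedEffect_eq (g : Reg β → ZMod 2) (P : XZ) (v : ZMod 2) :
    decodedEffect g (effect P) v = (1 / 2 : ℂ) • (1 + sgn v • decodedObs g P) := by
  rw [← sum_tensorOp_effect P, decodedObs, Finset.smul_sum, ← Finset.sum_add_distrib,
    Finset.smul_sum]
  refine Finset.sum_congr rfl fun u _ => ?_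
  rcases zmod_two_cases v with rfl | rfl <;> rcases zmod_two_cases (g u) with h | h <;>
    simp [h] <;> module

lemma decodedObs_isHermitian (g : Reg β → ZMod 2) (P : XZ) :
    (decodedObs g P)ᴴ = decodedObs g P := by
  simp [decodedObs, Matrix.conjTranspose_sum, tensorOp_conjTranspose, effect_isHermitian, star_sgn]

lemma decodedObs_mul_self (g : Reg β → ZMod 2) (P : XZ) :
    decodedObs g P * decodedObs g P = 1 := by
  simp only [decodedObs, Finset.sum_mul, Finset.mul_sum, smul_mul_assoc, mul_smul_comm,
    tensorOp_effect_mul, smul_ite, smul_zero, Finset.sum_ite_eq', Finset.mem_univ, if_true,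
    smul_smul, sgn_mul_self, one_smul, sum_tensorOp_effect]

end PauliStrings

/-! ### The code states and the logical operators -/

section Code

variable {m : ℕ} (Q : CSSCode m)

lemma mem_of_dualCode {C : Submodule (ZMod 2) (Fin m → ZMod 2)} {v : Fin m → ZMod 2}
    (h : ∀ w ∈ dualCode C, v ⬝ᵥ w = 0) : v ∈ C := by
  by_contra hv
  obtain ⟨f, hfv, hf⟩ := Submodule.exists_le_ker_of_notMem hv
  have hfw : ∀ x, f x = x ⬝ᵥ fun i => f (Pi.single i 1) := by
    intro x
    conv_lhs => rw [← Finset.univ_sum_single x]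
    simp only [map_sum, dotProduct]
    refine Finset.sum_congr rfl fun i _ => ?_
    rw [← smul_eq_mul, ← map_smul, ← Pi.single_smul, smul_eq_mul, mul_one]
  refine hfv ?_
  rw [hfw]
  exact h _ fun u hu => by rw [← hfw]; exact hf hu

lemma CSSCode.enc_apply (s : Reg (Fin m)) (b : ZMod 2) [Decidable (s - b • Q.lX ∈ Q.C₂)] :
    Q.enc s b = if s - b • Q.lX ∈ Q.C₂ then ((Real.sqrt (Nat.card Q.C₂))⁻¹ : ℂ) else 0 := by
  simp only [CSSCode.enc, Matrix.of_apply]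
  congr

lemma CSSCode.enc_shift (s c : Reg (Fin m)) (hc : c ∈ Q.C₂) (a b : ZMod 2) :
    Q.enc (s + c + a • Q.lX) (b + a) = Q.enc s b := by
  classical
  have h : s + c + a • Q.lX - (b + a) • Q.lX = (s - b • Q.lX) + c := by
    rw [add_smul]; abel
  simp only [Q.enc_apply, h, Submodule.add_mem_iff_left _ hc]

lemma CSSCode.mem_of_enc_ne_zero {s : Reg (Fin m)} {b : ZMod 2} (h : Q.enc s b ≠ 0) :
    s - b • Q.lX ∈ Q.C₂ := by
  classical
  rw [Q.enc_apply] at h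
  by_contra h'
  exact h (if_neg h')

lemma CSSCode.enc_support {s : Reg (Fin m)} {b : ZMod 2} (h : Q.enc s b ≠ 0) :
    Q.lZ ⬝ᵥ s = b := by
  have h1 := Q.lZ_mem _ (Q.mem_of_enc_ne_zero h)
  rw [sub_dotProduct, smul_dotProduct, Q.lX_dot_lZ, sub_eq_zero, dotProduct_comm] at h1
  simpa using h1

lemma CSSCode.mem_C₁_of_enc_ne_zero {s : Reg (Fin m)} {b : ZMod 2} (h : Q.enc s b ≠ 0) :
    s ∈ Q.C₁ := by
  have h1 := Q.C₁.add_mem (Q.le (Q.mem_of_enc_ne_zero h)) (Q.C₁.smul_mem b Q.lX_mem)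
  rwa [sub_add_cancel] at h1

lemma star_enc (s : Reg (Fin m)) (b : ZMod 2) : star (Q.enc s b) = Q.enc s b := by
  classical
  rw [Q.enc_apply]
  split_ifs <;> simp

lemma CSSCode.enc_isometry : Q.encᴴ * Q.enc = 1 := by
  classical
  ext b b'
  simp only [Matrix.mul_apply, Matrix.conjTranspose_apply, star_enc]
  by_cases hb : b = b'
  · subst hb
    rw [Matrix.one_apply_eq, ← Equiv.sum_comp (Equiv.addRight (b • Q.lX))]
    have hpos : (0 : ℝ) < Nat.card Q.C₂ := by exact_mod_cast Nat.card_pos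
    have hsq : ((Real.sqrt (Nat.card Q.C₂))⁻¹ : ℂ) * ((Real.sqrt (Nat.card Q.C₂))⁻¹ : ℂ) =
        (Nat.card Q.C₂ : ℂ)⁻¹ := by
      rw [← mul_inv]
      congr 1
      exact_mod_cast Real.mul_self_sqrt hpos.le
    have : ∀ s : Reg (Fin m), Q.enc (s + b • Q.lX) b * Q.enc (s + b • Q.lX) b =
        if s ∈ Q.C₂ then (Nat.card Q.C₂ : ℂ)⁻¹ else 0 := by
      intro s
      simp only [Q.enc_apply, add_sub_cancel_right]
      split_ifs
      · exact hsq
      · simp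
    simp only [Equiv.coe_addRight, this]
    rw [← Finset.sum_filter, Finset.sum_const, nsmul_eq_mul,
      ← Fintype.card_subtype, ← Nat.card_eq_fintype_card]
    exact mul_inv_cancel₀ (by exact_mod_cast hpos.ne')
  · rw [Matrix.one_apply_ne hb]
    refine Finset.sum_eq_zero fun s _ => ?_
    by_contra h
    exact hb ((Q.enc_support (left_ne_zero_of_mul h)).symm.trans
      (Q.enc_support (right_ne_zero_of_mul h)))

/-- The word along which the logical `X` or `Z` of one level acts. -/
def CSSCode.word : XZ → Fin m → ZMod 2
  | XZ.I => 0
  | XZ.X => Q.lX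
  | XZ.Z => Q.lZ

/-- The word along which the logical `X` or `Z` of `k` levels acts. -/
def CSSCode.blockWord (k : ℕ) (P : XZ) : Reg (Block m k) := fun q => ∏ l, Q.word P (q l)

lemma CSSCode.logical_eq (k : ℕ) (P : XZ) (q : Block m k) :
    Q.logical k P q = if Q.blockWord k P q = 1 then P else XZ.I := by
  cases P
  · simp [CSSCode.logical]
  · rfl
  · rfl

/-- A block of `k + 1` levels consists of `m` blocks of `k` levels. -/
def blockEquiv (m k : ℕ) : Fin m × Block m k ≃ Block m (k + 1) :=
  Fin.consEquiv fun _ => Fin m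

lemma blockWord_blockEquiv (k : ℕ) (P : XZ) (j : Fin m) (q : Block m k) :
    Q.blockWord (k + 1) P (blockEquiv m k (j, q)) = Q.word P j * Q.blockWord k P q := by
  simp [CSSCode.blockWord, blockEquiv, Fin.consEquiv, Fin.prod_univ_succ]

lemma blockWord_dotProduct (k : ℕ) (P : XZ) (s : Reg (Block m (k + 1))) :
    Q.blockWord (k + 1) P ⬝ᵥ s =
      Q.word P ⬝ᵥ fun j => Q.blockWord k P ⬝ᵥ regEquiv (blockEquiv m k) s j := by
  simp only [dotProduct]
  rw [← Equiv.sum_comp (blockEquiv m k), Fintype.sum_prod_type]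
  simp only [blockWord_blockEquiv, Finset.mul_sum, mul_assoc, regEquiv_apply]

lemma blockWord_X_dot_Z (k : ℕ) : Q.blockWord k XZ.X ⬝ᵥ Q.blockWord k XZ.Z = 1 := by
  induction k with
  | zero => simp [CSSCode.blockWord, dotProduct]
  | succ k ih =>
    have : (fun j => Q.blockWord k XZ.X ⬝ᵥ
        regEquiv (blockEquiv m k) (Q.blockWord (k + 1) XZ.Z) j) = Q.lZ := by
      funext j
      have : regEquiv (blockEquiv m k) (Q.blockWord (k + 1) XZ.Z) j =
          Q.lZ j • Q.blockWord k XZ.Z := by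
        funext q
        exact blockWord_blockEquiv Q k XZ.Z j q
      rw [this, dotProduct_smul, ih, smul_eq_mul, mul_one]
    rw [blockWord_dotProduct, this]
    exact Q.lX_dot_lZ

lemma concatEnc_zero_apply (s : Reg (Block m 0)) (b : ZMod 2) :
    Q.concatEnc 0 s b = if s Fin.elim0 = b then 1 else 0 := rfl

lemma concatEnc_zero_eq : Q.concatEnc 0 = (1 : QubitOp).submatrix
    (Equiv.funUnique (Block m 0) (ZMod 2)) id := by
  ext s b
  simp [concatEnc_zero_apply, Matrix.one_apply,
    Subsingleton.elim default (Fin.elim0 : Block m 0)]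

lemma concatEnc_succ (k : ℕ) :
    Q.concatEnc (k + 1) =
      (piTensor (fun _ : Fin m => Q.concatEnc k) * Q.enc).submatrix
        (regEquiv (blockEquiv m k)) id := rfl

lemma concatEnc_shift (k : ℕ) (s : Reg (Block m k)) (a b : ZMod 2) :
    Q.concatEnc k (s + a • Q.blockWord k XZ.X) (b + a) = Q.concatEnc k s b := by
  induction k generalizing a b with
  | zero => simp [concatEnc_zero_apply, CSSCode.blockWord]
  | succ k ih =>
    simp only [concatEnc_succ, Matrix.submatrix_apply, id, Matrix.mul_apply, piTensor_apply]
    rw [← Equiv.sum_comp (Equiv.addRight (a • Q.lX))]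
    refine Finset.sum_congr rfl fun y _ => ?_
    congr 1
    · refine Finset.prod_congr rfl fun j _ => ?_
      refine Eq.trans ?_ (ih (regEquiv (blockEquiv m k) s j) (a * Q.lX j) (y j))
      congr 1
      funext q
      simp only [regEquiv_apply, Pi.add_apply, Pi.smul_apply, blockWord_blockEquiv, smul_eq_mul,
        mul_assoc]
      rfl
    · simpa using Q.enc_shift y 0 (Q.C₂.zero_mem) a b

lemma concatEnc_support (k : ℕ) {s : Reg (Block m k)} {b : ZMod 2} (h : Q.concatEnc k s b ≠ 0) :
    Q.blockWord k XZ.Z ⬝ᵥ s = b := by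
  induction k generalizing b with
  | zero =>
    rw [concatEnc_zero_apply] at h
    by_contra h'
    refine h (if_neg fun h'' => h' ?_)
    rw [← h'']
    simp [CSSCode.blockWord, dotProduct, Subsingleton.elim _ (Fin.elim0 : Block m 0)]
  | succ k ih =>
    simp only [concatEnc_succ, Matrix.submatrix_apply, id, Matrix.mul_apply, piTensor_apply] at h
    obtain ⟨y, -, hy⟩ := Finset.exists_ne_zero_of_sum_ne_zero h
    have h1 : (fun j => Q.blockWord k XZ.Z ⬝ᵥ regEquiv (blockEquiv m k) s j) = y :=
      funext fun j => ih (Finset.prod_ne_zero_iff.1 (left_ne_zero_of_mul hy) j (Finset.mem_univ j))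
    rw [blockWord_dotProduct, h1]
    exact Q.enc_support (right_ne_zero_of_mul hy)

lemma submatrix_isometry {R S T : Type} [Fintype R] [Fintype S] (e : S ≃ R) (A B : Matrix R T ℂ) :
    (A.submatrix e id)ᴴ * B.submatrix e id = Aᴴ * B := by
  rw [Matrix.conjTranspose_submatrix, Matrix.submatrix_mul_equiv, Matrix.submatrix_id_id]

lemma piTensor_isometry {ι R C : Type} [Fintype ι] [DecidableEq ι] [Fintype R] [DecidableEq C]
    {A : ι → Matrix R C ℂ} (h : ∀ i, (A i)ᴴ * A i = 1) : (piTensor A)ᴴ * piTensor A = 1 := by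
  rw [piTensor_conjTranspose, piTensor_mul]
  simp only [h, piTensor_one]

lemma concatEnc_isometry (k : ℕ) : (Q.concatEnc k)ᴴ * Q.concatEnc k = 1 := by
  induction k with
  | zero =>
    rw [concatEnc_zero_eq, submatrix_isometry]
    simp
  | succ k ih =>
    rw [concatEnc_succ, submatrix_isometry, Matrix.conjTranspose_mul, Matrix.mul_assoc,
      ← Matrix.mul_assoc _ _ Q.enc, piTensor_isometry fun _ => ih, Matrix.one_mul, Q.enc_isometry]

lemma encReg_eq (n k : ℕ) :
    Q.encReg n k = (piTensor fun _ : Fin n => Q.concatEnc k).submatrix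
      (regEquiv (Equiv.refl _)) id := rfl

lemma encReg_isometry (n k : ℕ) : (Q.encReg n k)ᴴ * Q.encReg n k = 1 := by
  rw [encReg_eq, submatrix_isometry, piTensor_isometry fun _ => concatEnc_isometry Q k]

lemma reg_add_self {β : Type} (w : Reg β) : w + w = 0 :=
  funext fun q => CharTwo.add_self_eq_zero (w q)

lemma eq_add_iff_add_eq {β : Type} (s t w : Reg β) : s = t + w ↔ s + w = t := by
  constructor
  · rintro rfl; rw [add_assoc, reg_add_self, add_zero]
  · rintro rfl; rw [add_assoc, reg_add_self, add_zero]

/-- A Pauli string acts on an encoding as a Pauli operator acts on the encoded qubit, if the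
code words are shifted accordingly and have the corresponding parity. -/
lemma tensorOp_pauli_mul_eq {β : Type} [Fintype β] [DecidableEq β]
    {V : Matrix (Reg β) (ZMod 2) ℂ} {w : XZ → Reg β}
    (hX : ∀ s b, V (s + w XZ.X) (b + 1) = V s b) (hZ : ∀ s b, V s b ≠ 0 → w XZ.Z ⬝ᵥ s = b)
    (P : XZ) : tensorOp (fun q => pauli (if w P q = 1 then P else XZ.I)) * V = V * pauli P := by
  cases P
  · simp [pauli, tensorOp_one]
  · ext s b
    simp only [Matrix.mul_apply, tensorOp_pauli_X_apply, pauli_X_apply, ite_mul, one_mul, zero_mul,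
      mul_ite, mul_one, mul_zero, Finset.sum_ite_eq', Finset.mem_univ, if_true]
    simp only [eq_add_iff_add_eq, Finset.sum_ite_eq, Finset.mem_univ, if_true]
    rw [← hX (s + w XZ.X), add_assoc s, reg_add_self, add_zero]
  · ext s b
    simp only [Matrix.mul_apply, tensorOp_pauli_Z_apply, pauli_Z_apply, ite_mul, zero_mul,
      mul_ite, mul_zero, Finset.sum_ite_eq, Finset.sum_ite_eq', Finset.mem_univ, if_true]
    by_cases hV : V s b = 0
    · simp [hV]
    · rw [hZ s b hV, mul_comm]

lemma logical_mul_concatEnc (k : ℕ) (P : XZ) :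
    tensorOp (fun q => pauli (Q.logical k P q)) * Q.concatEnc k = Q.concatEnc k * pauli P := by
  simp only [CSSCode.logical_eq]
  refine tensorOp_pauli_mul_eq (fun s b => ?_) (fun s b => concatEnc_support Q k) P
  simpa using concatEnc_shift Q k s 1 b

lemma word_mul_enc (P : XZ) :
    tensorOp (fun j => pauli (if Q.word P j = 1 then P else XZ.I)) * Q.enc = Q.enc * pauli P := by
  refine tensorOp_pauli_mul_eq (w := Q.word) (fun s b => ?_) (fun s b => Q.enc_support) P
  simpa [CSSCode.word] using Q.enc_shift s 0 Q.C₂.zero_mem 1 b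

end Code

/-! ### Decoding one level -/

section Level

variable {m : ℕ} {Q : CSSCode m}

lemma SyndromeDecoder.bit_add {C : Submodule (ZMod 2) (Fin m → ZMod 2)} (D : SyndromeDecoder C)
    (l z : Fin m → ZMod 2) {c : Fin m → ZMod 2} (hc : c ∈ C) :
    D.bit l (z + c) = D.bit l z + l ⬝ᵥ c := by
  have h : (Submodule.Quotient.mk (z + c) : (Fin m → ZMod 2) ⧸ C) = Submodule.Quotient.mk z := by
    rw [Submodule.Quotient.eq, add_sub_cancel_left]
    exact hc
  rw [SyndromeDecoder.bit, SyndromeDecoder.bit, h, ← dotProduct_add]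
  congr 1
  abel

/-- The code of the outcomes of an ideal transversal measurement of a code state. -/
def CSSCode.outcomeCode (Q : CSSCode m) : XZ → Submodule (ZMod 2) (Fin m → ZMod 2)
  | XZ.I => ⊤
  | XZ.X => dualCode Q.C₂
  | XZ.Z => Q.C₁

/-- The decoded bit of one level of a block measured in the basis `P`. -/
def CSSCode.Decoder.levelBit (D : Q.Decoder) : XZ → Reg (Fin m) → ZMod 2
  | XZ.I => 0
  | XZ.X => D.decX.bit Q.lX
  | XZ.Z => D.decZ.bit Q.lZ

lemma decode_eq (D : Q.Decoder) {P : XZ} (hP : P ≠ XZ.I) (k : ℕ) :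
    D.decode k P = concatDecode (D.levelBit P) k := by
  cases P
  · exact absurd rfl hP
  · rfl
  · rfl

lemma decode_I (D : Q.Decoder) (k : ℕ) : D.decode k XZ.I = fun _ => 0 := rfl

lemma levelBit_add (D : Q.Decoder) {P : XZ} (hP : P ≠ XZ.I) (z : Reg (Fin m))
    {c : Reg (Fin m)} (hc : c ∈ Q.outcomeCode P) :
    D.levelBit P (z + c) = D.levelBit P z + Q.word P ⬝ᵥ c := by
  cases P
  · exact absurd rfl hP
  · exact D.decX.bit_add _ _ hc
  · exact D.decZ.bit_add _ _ hc

lemma levelBit_of_single_error {D : Q.Decoder} (hD : D.CorrectsSingleErrors) {P : XZ}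
    (hP : P ≠ XZ.I) {u y : Reg (Fin m)} (hu : u ∈ Q.outcomeCode P) {j : Fin m}
    (hy : ∀ i, i ≠ j → y i = u i) : D.levelBit P y = Q.word P ⬝ᵥ u := by
  have h : hammingNorm (y - u) ≤ 1 := by
    refine (Finset.card_le_card (t := {j}) fun i hi => ?_).trans (Finset.card_singleton j).le
    by_contra hij
    rw [Finset.mem_singleton] at hij
    simp [hy i hij] at hi
  rw [← sub_add_cancel y u, levelBit_add D hP _ hu]
  cases P
  · exact absurd rfl hP
  · simp [CSSCode.Decoder.levelBit, (hD _ h).1]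
  · simp [CSSCode.Decoder.levelBit, (hD _ h).2]

/-- The syndrome of a transversal measurement of a code state is trivial. -/
lemma effect_mul_enc_eq_zero {P : XZ} (hP : P ≠ XZ.I) {u : Reg (Fin m)}
    (hu : u ∉ Q.outcomeCode P) : tensorOp (fun j => effect P (u j)) * Q.enc = 0 := by
  cases P
  · exact absurd rfl hP
  · obtain ⟨c, hc, hcu⟩ : ∃ c ∈ Q.C₂, c ⬝ᵥ u = 1 := by
      by_contra! h
      exact hu fun c hc => (zmod_two_cases _).resolve_right (h c hc)
    -- the stabilizer along `c` fixes the code states and is `-1` on the outcome `u`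
    ext s b
    have h : (tensorOp (fun j => effect XZ.X (u j)) * Q.enc) s b =
        -(tensorOp (fun j => effect XZ.X (u j)) * Q.enc) s b := by
      conv_lhs => rw [Matrix.mul_apply, ← Equiv.sum_comp (Equiv.addRight c)]
      rw [Matrix.mul_apply, ← Finset.sum_neg_distrib]
      refine Finset.sum_congr rfl fun t _ => ?_
      have he : Q.enc (t + c) b = Q.enc t b := by simpa using Q.enc_shift t c hc 0 b
      simp only [Equiv.coe_addRight, tensorOp_effect_X_apply, he, ← add_assoc]
      rw [dotProduct_add, dotProduct_comm u c, hcu, sgn_add_one]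
      ring
    simpa using self_eq_neg.1 h
  · ext s b
    simp only [Matrix.mul_apply, tensorOp_effect_Z_apply, ite_mul, one_mul, zero_mul, ite_and,
      Matrix.zero_apply]
    refine Finset.sum_eq_zero fun t _ => ?_
    split_ifs with h1 h2
    · subst h2
      by_contra h
      exact hu (Q.mem_C₁_of_enc_ne_zero h)
    · rfl
    · rfl

/-- The decoded measurement of an encoded qubit is the measurement of the qubit. -/
lemma decodedEffect_mul_enc {D : Q.Decoder} (hD : D.CorrectsSingleErrors) {P : XZ}
    (hP : P ≠ XZ.I) (v : ZMod 2) :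
    decodedEffect (D.levelBit P) (effect P) v * Q.enc = Q.enc * effect P v := by
  have h : decodedObs (D.levelBit P) P * Q.enc = Q.enc * pauli P := by
    rw [← word_mul_enc, ← sum_sgn_smul_tensorOp_effect hP (Q.word P), decodedObs, Matrix.sum_mul,
      Matrix.sum_mul]
    refine Finset.sum_congr rfl fun u _ => ?_
    by_cases hu : u ∈ Q.outcomeCode P
    · have : D.levelBit P u = Q.word P ⬝ᵥ u := by
        have h0 := levelBit_add D hP 0 hu
        have hz : hammingNorm (0 : Reg (Fin m)) ≤ 1 := by simp
        have h1 : D.levelBit P 0 = 0 := by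
          cases P
          · rfl
          · exact (hD 0 hz).1
          · exact (hD 0 hz).2
        rwa [zero_add, h1, zero_add] at h0
      rw [this]
    · simp only [Matrix.smul_mul, effect_mul_enc_eq_zero hP hu, smul_zero]
  rw [decodedEffect_eq, effect_eq hP]
  simp only [Matrix.smul_mul, Matrix.mul_smul, Matrix.add_mul, Matrix.mul_add, Matrix.one_mul,
    Matrix.mul_one, h]

/-- The decoded `X` and `Z` observables of a block anticommute, on all states and not only on
code states. In the computational basis the decoded `X` observable is a combination of shifts by
words of `lX + C₂`: shifting the argument of its Fourier transform by `w ∈ C₂ᗮ` multiplies it by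
`(-1)^(lX · w)`. Such a shift does not change the `Z` syndrome, and it flips the decoded
`Z` bit. -/
lemma decodedObs_anticomm (D : Q.Decoder) :
    decodedObs (D.levelBit XZ.X) XZ.X * decodedObs (D.levelBit XZ.Z) XZ.Z =
      -(decodedObs (D.levelBit XZ.Z) XZ.Z * decodedObs (D.levelBit XZ.X) XZ.X) := by
  set G : Reg (Fin m) → ℂ := fun c =>
    ∑ u : Reg (Fin m), sgn (D.levelBit XZ.X u) * ((1 / 2) ^ m * sgn (u ⬝ᵥ c)) with hG
  have hX : ∀ s t, decodedObs (D.levelBit XZ.X) XZ.X s t = G (s + t) := by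
    intro s t
    simp [decodedObs, Matrix.sum_apply, tensorOp_effect_X_apply, hG]
  have hZ : ∀ s t, decodedObs (D.levelBit XZ.Z) XZ.Z s t =
      if s = t then sgn (D.levelBit XZ.Z s) else 0 := by
    intro s t
    simp only [decodedObs, Matrix.sum_apply, Matrix.smul_apply, tensorOp_effect_Z_apply,
      smul_eq_mul, mul_ite, mul_one, mul_zero, ite_and, Finset.sum_ite_eq, Finset.mem_univ, if_true,
      eq_comm (a := t)]
  have hshift : ∀ c, G c ≠ 0 → c + Q.lX ∈ Q.C₂ := by
    intro c hc
    refine mem_of_dualCode fun w hw => ?_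
    have h : G c = sgn ((c + Q.lX) ⬝ᵥ w) * G c := by
      simp only [hG, Finset.mul_sum]
      rw [← Equiv.sum_comp (Equiv.addRight w)]
      refine Finset.sum_congr rfl fun u _ => ?_
      have h1 : D.levelBit XZ.X (u + w) = D.levelBit XZ.X u + Q.lX ⬝ᵥ w :=
        levelBit_add D (by simp) u hw
      simp only [Equiv.coe_addRight, h1, add_dotProduct, sgn_add, dotProduct_comm w c]
      ring
    rcases zmod_two_cases ((c + Q.lX) ⬝ᵥ w) with h' | h'
    · exact h'
    · rw [h', sgn_one, neg_one_mul] at h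
      exact absurd (self_eq_neg.1 h) hc
  ext s t
  simp only [Matrix.mul_apply, Matrix.neg_apply, hX, hZ, mul_ite, ite_mul, zero_mul, mul_zero,
    Finset.sum_ite_eq, Finset.sum_ite_eq', Finset.mem_univ, if_true]
  by_cases hst : G (s + t) = 0
  · simp [hst]
  · have hmem := hshift _ hst
    have h1 : s + t ∈ Q.C₁ := by
      have := Q.C₁.sub_mem (Q.le hmem) Q.lX_mem
      rwa [add_sub_cancel_right] at this
    have h2 : Q.lZ ⬝ᵥ (s + t) = 1 := by
      have := Q.lZ_mem _ hmem
      rw [add_dotProduct, Q.lX_dot_lZ] at this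
      rw [dotProduct_comm]
      exact CharTwo.add_eq_zero.1 this
    have h3 : D.levelBit XZ.Z s = D.levelBit XZ.Z t + 1 := by
      have := levelBit_add D (P := XZ.Z) (by simp) t h1
      rw [add_comm s t, ← add_assoc, reg_add_self, zero_add, add_comm t s] at this
      exact this.trans (congrArg _ h2)
    rw [h3, sgn_add_one]
    ring

end Level

/-! ### Extracting a qubit from a pair of anticommuting observables -/

/-- Kraus operators `(W a)ᴴ` of a channel that extracts the qubit on which the anticommuting
observables `X̂`, `Ẑ` act as the Pauli operators: `W a` maps `|b⟩` to `X̂ᵇ (1 + Ẑ)/2 |a⟩`. -/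
lemma exists_kraus_of_anticomm {κ : Type} [Fintype κ] [DecidableEq κ] {Xh Zh : Matrix κ κ ℂ}
    (hX : Xhᴴ = Xh) (hZ : Zhᴴ = Zh) (hXX : Xh * Xh = 1) (hZZ : Zh * Zh = 1)
    (hXZ : Xh * Zh = -(Zh * Xh)) :
    ∃ W : κ → Matrix κ (ZMod 2) ℂ, (∀ a, Xh * W a = W a * pauli XZ.X) ∧
      (∀ a, Zh * W a = W a * pauli XZ.Z) ∧ ∑ a, W a * (W a)ᴴ = 1 := by
  set Z₀ : Matrix κ κ ℂ := (1 / 2 : ℂ) • (1 + Zh) with hZ₀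
  set M : ZMod 2 → Matrix κ κ ℂ := fun b => if b = 0 then Z₀ else Xh * Z₀ with hM
  have hM1 : ∀ b, Xh * M b = M (b + 1) := by
    intro b
    rcases zmod_two_cases b with rfl | rfl
    · simp [hM]
    · simp [hM, CharTwo.add_self_eq_zero, ← Matrix.mul_assoc, hXX]
  have hZ0 : Zh * Z₀ = Z₀ := by
    rw [hZ₀, mul_smul_comm, mul_add, mul_one, hZZ, add_comm]
  have hM2 : ∀ b, Zh * M b = sgn b • M b := by
    intro b
    rcases zmod_two_cases b with rfl | rfl
    · simp [hM, hZ0]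
    · have : Zh * Xh = -(Xh * Zh) := by rw [hXZ, neg_neg]
      simp only [hM, one_ne_zero, if_false, sgn_one, neg_smul, one_smul]
      rw [← Matrix.mul_assoc, this, Matrix.neg_mul, Matrix.mul_assoc, hZ0]
  have hM3 : ∑ b, M b * (M b)ᴴ = 1 := by
    have h0 : Z₀ * Z₀ᴴ = Z₀ := by
      have : Z₀ᴴ = Z₀ := by simp [hZ₀, hZ]
      rw [this]
      nth_rewrite 1 [hZ₀]
      rw [smul_mul_assoc, add_mul, one_mul, hZ0]
      module
    have h1 : Xh * Z₀ * (Xh * Z₀)ᴴ = (1 / 2 : ℂ) • (1 - Zh) := by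
      rw [Matrix.conjTranspose_mul, Matrix.mul_assoc, ← Matrix.mul_assoc Z₀, h0, hX, hZ₀,
        smul_mul_assoc, mul_smul_comm, add_mul, one_mul, mul_add, hXX, ← Matrix.mul_assoc, hXZ,
        Matrix.neg_mul, Matrix.mul_assoc, hXX, mul_one, sub_eq_add_neg]
    rw [sum_zmod_two]
    simp only [hM, if_true, one_ne_zero, if_false, h0, h1]
    rw [hZ₀]
    module
  refine ⟨fun a => Matrix.of fun s b => M b s a, fun a => ?_, fun a => ?_, ?_⟩
  · ext s b
    have := congrFun (congrFun (hM1 b) s) a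
    simp only [Matrix.mul_apply, Matrix.of_apply, pauli_X_apply] at this ⊢
    rw [this]
    simp
  · ext s b
    have := congrFun (congrFun (hM2 b) s) a
    simp only [Matrix.mul_apply, Matrix.of_apply, pauli_Z_apply, Matrix.smul_apply,
      smul_eq_mul] at this ⊢
    rw [this]
    simp [mul_comm]
  · rw [← hM3]
    ext s t
    simp only [Matrix.sum_apply, Matrix.mul_apply, Matrix.conjTranspose_apply, Matrix.of_apply]
    exact Finset.sum_comm

section Recovery

variable {m : ℕ} {Q : CSSCode m}

lemma exists_kraus_decodedEffect_level (D : Q.Decoder) :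
    ∃ W : Reg (Fin m) → Matrix (Reg (Fin m)) (ZMod 2) ℂ, (∑ a, W a * (W a)ᴴ = 1) ∧
      ∀ P ≠ XZ.I, ∀ v, ∑ a, W a * effect P v * (W a)ᴴ =
        decodedEffect (D.levelBit P) (effect P) v := by
  obtain ⟨W, hX, hZ, h1⟩ := exists_kraus_of_anticomm (decodedObs_isHermitian _ _)
    (decodedObs_isHermitian _ _) (decodedObs_mul_self _ _) (decodedObs_mul_self _ _)
    (decodedObs_anticomm D)
  refine ⟨W, h1, fun P hP v => ?_⟩
  have hPW : ∀ a, decodedObs (D.levelBit P) P * W a = W a * pauli P := by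
    cases P
    · exact absurd rfl hP
    · exact hX
    · exact hZ
  rw [decodedEffect_eq, effect_eq hP, ← Matrix.mul_one (decodedObs _ _), ← h1, Matrix.mul_sum,
    Finset.smul_sum, ← Finset.sum_add_distrib, Finset.smul_sum]
  refine Finset.sum_congr rfl fun a _ => ?_
  rw [← Matrix.mul_assoc, hPW]
  simp only [Matrix.smul_mul, Matrix.mul_smul, Matrix.add_mul, Matrix.mul_add, Matrix.mul_one]

lemma concatDecode_succ (d : Reg (Fin m) → ZMod 2) (k : ℕ) :
    concatDecode d (k + 1) =
      fun s => d fun j => concatDecode d k (regEquiv (blockEquiv m k) s j) := rfl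

lemma decodedEffect_concatDecode_zero (d : Reg (Fin m) → ZMod 2) (f : ZMod 2 → QubitOp)
    (v : ZMod 2) : decodedEffect (concatDecode d 0) f v =
      (f v).submatrix (Equiv.funUnique (Block m 0) (ZMod 2))
        (Equiv.funUnique (Block m 0) (ZMod 2)) := by
  rw [decodedEffect, ← Equiv.sum_comp (Equiv.funUnique (Block m 0) (ZMod 2)).symm]
  simp only [concatDecode, Equiv.funUnique_symm_apply, uniqueElim_const, Finset.sum_ite_eq',
    Finset.mem_univ, if_true]
  ext s t
  simp [tensorOp]

/-- The decoded measurements of a block are ideal measurements of a single qubit that a channel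
(with Kraus operators `(W a)ᴴ`, not depending on the basis) extracts from the block. -/
lemma exists_kraus_decodedEffect (D : Q.Decoder) (k : ℕ) :
    ∃ (A : Type) (_ : Fintype A) (W : A → Matrix (Reg (Block m k)) (ZMod 2) ℂ),
      ∀ P v, ∑ a, W a * effect P v * (W a)ᴴ = decodedEffect (D.decode k P) (effect P) v := by
  suffices h : ∃ (A : Type) (_ : Fintype A) (W : A → Matrix (Reg (Block m k)) (ZMod 2) ℂ),
      (∑ a, W a * (W a)ᴴ = 1) ∧ ∀ P ≠ XZ.I, ∀ v, ∑ a, W a * effect P v * (W a)ᴴ =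
        decodedEffect (concatDecode (D.levelBit P) k) (effect P) v by
    obtain ⟨A, hA, W, h1, hW⟩ := h
    refine ⟨A, hA, W, fun P v => ?_⟩
    by_cases hP : P = XZ.I
    · subst hP
      rw [decode_I, decodedEffect_zero (sum_effect _)]
      simp only [effect]
      split_ifs
      · simpa using h1
      · simp
    · rw [decode_eq D hP, hW P hP]
  induction k with
  | zero =>
    have hE : ∀ B : QubitOp, (1 : QubitOp).submatrix (Equiv.funUnique (Block m 0) (ZMod 2)) id *
        B * ((1 : QubitOp).submatrix (Equiv.funUnique (Block m 0) (ZMod 2)) id)ᴴ =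
        B.submatrix (Equiv.funUnique (Block m 0) (ZMod 2))
          (Equiv.funUnique (Block m 0) (ZMod 2)) := by
      intro B
      rw [submatrix_mul_left, Matrix.conjTranspose_submatrix]
      ext s t
      simp [Matrix.mul_apply, Matrix.one_apply]
    refine ⟨Unit, inferInstance, fun _ => (1 : QubitOp).submatrix (Equiv.funUnique _ _) id,
      ?_, fun P _ v => ?_⟩
    · have := hE 1
      rw [Matrix.mul_one, Matrix.submatrix_one_equiv] at this
      simpa only [Finset.univ_unique, Finset.sum_singleton] using this
    · rw [decodedEffect_concatDecode_zero, ← hE]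
      simp
  | succ k ih =>
    obtain ⟨A, hA, W, h1, hW⟩ := ih
    obtain ⟨W', h1', hW'⟩ := exists_kraus_decodedEffect_level D
    have key : ∀ B : QubitOp, ∑ p : (Fin m → A) × Reg (Fin m),
        (piTensor (fun i => W (p.1 i)) * W' p.2).submatrix (regEquiv (blockEquiv m k)) id * B *
        ((piTensor (fun i => W (p.1 i)) * W' p.2).submatrix (regEquiv (blockEquiv m k)) id)ᴴ =
        (∑ a : Fin m → A, piTensor (fun i => W (a i)) * (∑ c, W' c * B * (W' c)ᴴ) *
          (piTensor (fun i => W (a i)))ᴴ).submatrix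
            (regEquiv (blockEquiv m k)) (regEquiv (blockEquiv m k)) := by
      intro B
      rw [Fintype.sum_prod_type]
      ext s t
      simp only [Matrix.sum_apply, Matrix.submatrix_apply]
      refine Finset.sum_congr rfl fun a _ => ?_
      rw [Matrix.mul_sum, Matrix.sum_mul, Matrix.sum_apply]
      refine Finset.sum_congr rfl fun c _ => ?_
      rw [submatrix_mul_left, Matrix.conjTranspose_submatrix, submatrix_mul_left,
        Matrix.conjTranspose_mul]
      simp only [Matrix.mul_assoc]
      simp [Matrix.mul_apply]
    refine ⟨(Fin m → A) × Reg (Fin m), inferInstance, fun p =>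
      (piTensor (fun i => W (p.1 i)) * W' p.2).submatrix (regEquiv (blockEquiv m k)) id,
      ?_, fun P hP v => ?_⟩
    · have := key 1
      simp only [Matrix.mul_one, h1'] at this
      rw [this]
      simp only [piTensor_conjTranspose, piTensor_mul]
      rw [← piTensor_sum fun (_ : Fin m) a => W a * (W a)ᴴ, h1, piTensor_one]
      simp
    · rw [key, hW' P hP, concatDecode_succ,
        decodedEffect_blocks (blockEquiv m k) (D.levelBit P) (concatDecode (D.levelBit P) k)]
      congr 1
      have h2 : ∀ a : Fin m → A, piTensor (fun i => W (a i)) *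
          decodedEffect (D.levelBit P) (effect P) v * (piTensor fun i => W (a i))ᴴ =
          ∑ y, if D.levelBit P y = v then
            piTensor (fun i => W (a i) * effect P (y i) * (W (a i))ᴴ) else 0 := by
        intro a
        rw [decodedEffect, Matrix.mul_sum, Matrix.sum_mul]
        refine Finset.sum_congr rfl fun y _ => ?_
        split_ifs
        · rw [tensorOp_eq_piTensor, piTensor_mul, piTensor_conjTranspose, piTensor_mul]
        · simp
      simp only [h2]
      rw [Finset.sum_comm]
      refine Finset.sum_congr rfl fun y _ => ?_
      split_ifs
      · simp only [← hW P hP]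
        rw [piTensor_sum]
      · simp

end Recovery

/-! ### Operators decomposed into copies of a smaller operator -/

section Copies

variable {κ κ' A : Type} [Fintype κ] [Fintype κ'] [Fintype A]
  {H' : Matrix κ κ ℂ} {H : Matrix κ' κ' ℂ} {W : A → Matrix κ κ' ℂ} {V : Matrix κ κ' ℂ}

lemma dotProduct_star_self_eq (φ : κ → ℂ) :
    star φ ⬝ᵥ φ = ((∑ i, Complex.normSq (φ i) : ℝ) : ℂ) := by
  simp [dotProduct, Complex.normSq_eq_conj_mul_self]

lemma star_mulVec_dotProduct (M : Matrix κ κ' ℂ) (x : κ' → ℂ) (y : κ → ℂ) :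
    star (M *ᵥ x) ⬝ᵥ y = star x ⬝ᵥ (Mᴴ *ᵥ y) := by
  rw [Matrix.star_mulVec, Matrix.dotProduct_mulVec]

lemma IsUnitVec.mulVec [DecidableEq κ'] (hV : Vᴴ * V = 1) {ψ : κ' → ℂ} (h : IsUnitVec ψ) :
    IsUnitVec (V *ᵥ ψ) := by
  rw [IsUnitVec, star_mulVec_dotProduct, Matrix.mulVec_mulVec, hV, Matrix.one_mulVec]
  exact h

lemma energy_mulVec [DecidableEq κ'] (hV : Vᴴ * V = 1) (hHV : H' * V = V * H) (ψ : κ' → ℂ) :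
    energy H' (V *ᵥ ψ) = energy H ψ := by
  rw [energy, energy, star_mulVec_dotProduct, Matrix.mulVec_mulVec, Matrix.mulVec_mulVec,
    Matrix.mul_assoc, hHV, ← Matrix.mul_assoc, hV, Matrix.one_mul]

lemma energy_smul (c : ℂ) (φ : κ → ℂ) :
    energy (κ := κ) (H') (c • φ) = Complex.normSq c * energy H' φ := by
  have h : (star c) * c = ((Complex.normSq c : ℝ) : ℂ) :=
    (Complex.normSq_eq_conj_mul_self).symm
  rw [energy, energy, star_smul, Matrix.mulVec_smul, smul_dotProduct, dotProduct_smul, smul_smul,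
    h, smul_eq_mul, Complex.re_ofReal_mul]

lemma le_energy_of_forall_unit {c : ℝ} (h : ∀ φ, IsUnitVec φ → c ≤ energy H' φ) (φ : κ → ℂ) :
    c * (star φ ⬝ᵥ φ).re ≤ energy H' φ := by
  set N : ℝ := ∑ i, Complex.normSq (φ i) with hN
  have hφ : star φ ⬝ᵥ φ = (N : ℂ) := dotProduct_star_self_eq φ
  have hN0 : 0 ≤ N := Finset.sum_nonneg fun i _ => Complex.normSq_nonneg _
  rw [hφ, Complex.ofReal_re]
  rcases hN0.eq_or_lt with h0 | h0
  · have hz : φ = 0 := by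
      funext i
      have := (Finset.sum_eq_zero_iff_of_nonneg fun i _ => Complex.normSq_nonneg (φ i)).1
        h0.symm i (Finset.mem_univ i)
      simpa using this
    rw [← h0, hz]
    simp [energy]
  · have hu : IsUnitVec (((Real.sqrt N)⁻¹ : ℂ) • φ) := by
      rw [IsUnitVec, star_smul, smul_dotProduct, dotProduct_smul, hφ, smul_smul, smul_eq_mul]
      have : ((Real.sqrt N : ℝ) : ℂ) ≠ 0 := by
        exact_mod_cast (Real.sqrt_pos.2 h0).ne'
      have hs : ((N : ℝ) : ℂ) = (Real.sqrt N : ℂ) * (Real.sqrt N : ℂ) := by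
        exact_mod_cast (Real.mul_self_sqrt h0.le).symm
      rw [hs, star_inv₀, Complex.star_def, Complex.conj_ofReal]
      field_simp
    have h1 := h _ hu
    rw [energy_smul, ← Complex.ofReal_inv, Complex.normSq_ofReal, ← mul_inv,
      Real.mul_self_sqrt h0.le] at h1
    rwa [inv_mul_eq_div, le_div_iff₀ h0] at h1

lemma star_dotProduct_mulVec_sum (hW : ∀ a, H' * W a = W a * H) [DecidableEq κ]
    (h1 : ∑ a, W a * (W a)ᴴ = 1) (φ : κ → ℂ) :
    star φ ⬝ᵥ (H' *ᵥ φ) =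
      ∑ a, star ((W a)ᴴ *ᵥ φ) ⬝ᵥ (H *ᵥ ((W a)ᴴ *ᵥ φ)) := by
  have h : H' = ∑ a, W a * H * (W a)ᴴ := by
    rw [← Matrix.mul_one H', ← h1, Matrix.mul_sum]
    exact Finset.sum_congr rfl fun a _ => by rw [← Matrix.mul_assoc, hW]
  conv_lhs => rw [h, Matrix.sum_mulVec, dotProduct_sum]
  refine Finset.sum_congr rfl fun a _ => ?_
  rw [star_mulVec_dotProduct, Matrix.conjTranspose_conjTranspose, Matrix.mulVec_mulVec,
    Matrix.mulVec_mulVec, Matrix.mul_assoc]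

/-- An operator that is a direct sum of copies of `H` has the same lower energy bounds. -/
lemma energy_bound_iff [DecidableEq κ] [DecidableEq κ'] (hW : ∀ a, H' * W a = W a * H)
    (h1 : ∑ a, W a * (W a)ᴴ = 1) (hV : Vᴴ * V = 1) (hHV : H' * V = V * H) (c : ℝ) :
    (∀ φ, IsUnitVec φ → c ≤ energy H φ) ↔ ∀ φ, IsUnitVec φ → c ≤ energy H' φ := by
  constructor
  · intro h φ hφ
    have h2 := star_dotProduct_mulVec_sum (H' := 1) (H := 1) (W := W) (by simp) h1 φ
    simp only [Matrix.one_mulVec] at h2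
    rw [hφ] at h2
    rw [energy, star_dotProduct_mulVec_sum hW h1, Complex.re_sum]
    calc c = c * (1 : ℂ).re := by simp
      _ = ∑ a, c * (star ((W a)ᴴ *ᵥ φ) ⬝ᵥ ((W a)ᴴ *ᵥ φ)).re := by
        rw [h2, Complex.re_sum, Finset.mul_sum]
      _ ≤ _ := Finset.sum_le_sum fun a _ => le_energy_of_forall_unit h _
  · intro h φ hφ
    rw [← energy_mulVec hV hHV]
    exact h _ (hφ.mulVec hV)

/-- An operator that is a direct sum of copies of `H` has the same spectrum. -/
lemma spectrum_eq_of_copies [DecidableEq κ] [DecidableEq κ'] (hW : ∀ a, H' * W a = W a * H)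
    (h1 : ∑ a, W a * (W a)ᴴ = 1) (hV : Vᴴ * V = 1) (hHV : H' * V = V * H) :
    spectrum ℂ H' = spectrum ℂ H := by
  ext z
  rw [spectrum.mem_iff, spectrum.mem_iff, not_iff_not]
  have hz : ∀ U : Matrix κ κ' ℂ, H' * U = U * H →
      (algebraMap ℂ (Matrix κ κ ℂ) z - H') * U = U * (algebraMap ℂ (Matrix κ' κ' ℂ) z - H) := by
    intro U hU
    rw [Matrix.sub_mul, Matrix.mul_sub, hU, Algebra.algebraMap_eq_smul_one,
      Algebra.algebraMap_eq_smul_one, Matrix.smul_mul, Matrix.mul_smul, Matrix.one_mul,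
      Matrix.mul_one]
  constructor
  · rintro ⟨u, hu⟩
    have h : (Vᴴ * (↑u⁻¹ : Matrix κ κ ℂ) * V) * (algebraMap ℂ (Matrix κ' κ' ℂ) z - H) = 1 := by
      rw [Matrix.mul_assoc, ← hz V hHV, ← hu, Matrix.mul_assoc, ← Matrix.mul_assoc _ (u : Matrix κ κ ℂ),
        Units.inv_mul, Matrix.one_mul, hV]
    exact IsUnit.of_mul_eq_one_right _ h
  · rintro ⟨u, hu⟩
    have h : (algebraMap ℂ (Matrix κ κ ℂ) z - H') *
        (∑ a, W a * (↑u⁻¹ : Matrix κ' κ' ℂ) * (W a)ᴴ) = 1 := by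
      rw [Matrix.mul_sum, ← h1]
      refine Finset.sum_congr rfl fun a _ => ?_
      rw [← Matrix.mul_assoc, ← Matrix.mul_assoc, hz _ (hW a), ← hu, Matrix.mul_assoc (W a),
        Units.mul_inv, Matrix.mul_one]
    exact IsUnit.of_mul_eq_one _ h

end Copies

/-! ### The encoded Hamiltonian -/

section EncHam

variable {m : ℕ} (Q : CSSCode m)

lemma tensorOp_blocks_mul {ι β : Type} [Fintype ι] [DecidableEq ι] [Fintype β]
    [DecidableEq β] {A : ι × β → QubitOp} {B : ι → QubitOp}
    {U : ι → Matrix (Reg β) (ZMod 2) ℂ}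
    (h : ∀ i, tensorOp (fun q => A (i, q)) * U i = U i * B i) :
    tensorOp A * (piTensor U).submatrix (regEquiv (Equiv.refl (ι × β))) id =
      (piTensor U).submatrix (regEquiv (Equiv.refl (ι × β))) id * tensorOp B := by
  rw [tensorOp_eq_submatrix (Equiv.refl (ι × β)) A, Matrix.submatrix_mul_equiv,
    submatrix_mul_left, piTensor_mul, tensorOp_eq_piTensor, piTensor_mul]
  simp only [Equiv.refl_apply, h]

lemma encHam_mul {n k : ℕ} (H : XZHamiltonian n)
    {U : Fin n → Matrix (Reg (Block m k)) (ZMod 2) ℂ}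
    (h : ∀ i P, tensorOp (fun q => pauli (Q.logical k P q)) * U i = U i * pauli P) :
    Q.encHam k H * (piTensor U).submatrix (regEquiv (Equiv.refl (Fin n × Block m k))) id =
      (piTensor U).submatrix (regEquiv (Equiv.refl (Fin n × Block m k))) id * H.op := by
  rw [CSSCode.encHam, XZHamiltonian.op, Matrix.sum_mul, Matrix.mul_sum]
  refine Finset.sum_congr rfl fun i _ => ?_
  rw [Matrix.smul_mul, Matrix.mul_smul]
  congr 1
  exact tensorOp_blocks_mul (A := fun p => pauli (Q.logical k (H.term i p.1) p.2))
    (B := fun j => pauli (H.term i j)) fun j => h j (H.term i j)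

/-- The encoded Hamiltonian is a direct sum of copies of the Hamiltonian. -/
lemma exists_copies_encHam (n k : ℕ) :
    ∃ W : (Fin n → Reg (Block m k)) → Matrix (Reg (Fin n × Block m k)) (Reg (Fin n)) ℂ,
      (∑ a, W a * (W a)ᴴ = 1) ∧ ∀ (H : XZHamiltonian n) a, Q.encHam k H * W a = W a * H.op := by
  have hXZ := tensorOp_pauli_anticomm (blockWord_X_dot_Z Q k)
  obtain ⟨W, hX, hZ, h1⟩ := exists_kraus_of_anticomm (tensorOp_pauli_isHermitian _)
    (tensorOp_pauli_isHermitian _) (tensorOp_pauli_mul_self _) (tensorOp_pauli_mul_self _) hXZ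
  refine ⟨fun a => (piTensor fun i => W (a i)).submatrix (regEquiv (Equiv.refl _)) id, ?_,
    fun H a => encHam_mul Q H fun i P => ?_⟩
  · have : ∀ a : Fin n → Reg (Block m k),
        (piTensor fun i => W (a i)).submatrix (regEquiv (Equiv.refl (Fin n × Block m k))) id *
        ((piTensor fun i => W (a i)).submatrix (regEquiv (Equiv.refl _)) id)ᴴ =
        (piTensor fun i => W (a i) * (W (a i))ᴴ).submatrix (regEquiv (Equiv.refl _))
          (regEquiv (Equiv.refl _)) := by
      intro a
      rw [submatrix_mul_left, Matrix.conjTranspose_submatrix, ← piTensor_mul,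
        piTensor_conjTranspose]
      ext s t
      simp [Matrix.mul_apply]
    simp only [this]
    have h2 := piTensor_sum fun (_ : Fin n) a => W a * (W a)ᴴ
    simp only [h1, piTensor_one] at h2
    ext s t
    rw [Matrix.sum_apply]
    have h3 := congrFun (congrFun h2 (regEquiv (Equiv.refl _) s)) (regEquiv (Equiv.refl _) t)
    rw [Matrix.sum_apply] at h3
    simp only [Matrix.submatrix_apply, ← h3, Matrix.one_apply, EmbeddingLike.apply_eq_iff_eq]
  · simp only [CSSCode.logical_eq]
    cases P
    · simp [pauli, tensorOp_one]
    · exact hX _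
    · exact hZ _

lemma encHam_mul_encReg {n k : ℕ} (H : XZHamiltonian n) :
    Q.encHam k H * Q.encReg n k = Q.encReg n k * H.op :=
  encHam_mul Q H fun _ P => logical_mul_concatEnc Q k P

end EncHam

/-! ### The unitary encoding circuit -/

section Unitary

lemma blockPow_eq {β : Type} [Fintype β] (n : ℕ) (E : Op β) :
    blockPow n E = (piTensor fun _ : Fin n => E).submatrix
      (regEquiv (Equiv.refl _)) (regEquiv (Equiv.refl _)) := rfl

variable {β : Type} [Fintype β] [DecidableEq β]

lemma two_mul_card_parity {l c : Reg β} (h : l ⬝ᵥ c = 1) :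
    2 * Fintype.card {s : Reg β // l ⬝ᵥ s = 0} = Fintype.card (Reg β) := by
  have h1 := Fintype.card_subtype_compl fun s : Reg β => l ⬝ᵥ s = 0
  have h2 : Fintype.card {s : Reg β // ¬ l ⬝ᵥ s = 0} = Fintype.card {s : Reg β // l ⬝ᵥ s = 0} := by
    refine Fintype.card_congr ((Equiv.addRight c).subtypeEquiv fun s => ?_)
    rw [Equiv.coe_addRight, dotProduct_add, h]
    rcases zmod_two_cases (l ⬝ᵥ s) with h' | h' <;> simp [h', CharTwo.add_self_eq_zero]
  have h3 := Fintype.card_subtype_le fun s : Reg β => l ⬝ᵥ s = 0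
  omega

/-- The code state `V|0⟩` is the member `0` of an orthonormal basis of the eigenspace
`Ẑ = 1`, which is indexed by the strings of the ancillas. -/
lemma exists_ancilla_basis {V : Matrix (Reg β) (ZMod 2) ℂ} {wX wZ : Reg β}
    (hw : wZ ⬝ᵥ wX = 1) (hV : Vᴴ * V = 1) (hZ : ∀ s b, V s b ≠ 0 → wZ ⬝ᵥ s = b) (q₀ : β) :
    ∃ w : Reg β → Reg β → ℂ, (∀ s, w 0 s = V s 0) ∧ (∀ a s, w a s ≠ 0 → wZ ⬝ᵥ s = 0) ∧
      ∀ a a', a q₀ = 0 → a' q₀ = 0 → ∑ s, star (w a s) * w a' s = if a = a' then 1 else 0 := by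
  have hsum : ∀ f : Reg β → ℂ, (∀ s, f s ≠ 0 → wZ ⬝ᵥ s = 0) →
      ∑ s, f s = ∑ s : {s : Reg β // wZ ⬝ᵥ s = 0}, f s := by
    intro f hf
    rw [← Finset.sum_subtype (Finset.univ.filter fun s => wZ ⬝ᵥ s = 0) (by simp) f,
      Finset.sum_filter]
    refine Finset.sum_congr rfl fun s _ => ?_
    split_ifs with h
    · rfl
    · by_contra h'
      exact h (hf s h')
  have hcard : Module.finrank ℂ (EuclideanSpace ℂ {s : Reg β // wZ ⬝ᵥ s = 0}) =
      Fintype.card {a : Reg β // a q₀ = 0} := by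
    have h1 := two_mul_card_parity hw
    have h2 := two_mul_card_parity (β := β) (l := Pi.single q₀ 1) (c := Pi.single q₀ 1) (by simp)
    have h3 : Fintype.card {a : Reg β // a q₀ = 0} =
        Fintype.card {a : Reg β // Pi.single q₀ 1 ⬝ᵥ a = 0} :=
      Fintype.card_congr (Equiv.subtypeEquivRight fun a => by simp)
    rw [finrank_euclideanSpace, h3]
    omega
  set v : {a : Reg β // a q₀ = 0} → EuclideanSpace ℂ {s : Reg β // wZ ⬝ᵥ s = 0} :=
    fun _ => WithLp.toLp 2 fun s => V s 0 with hv
  have hnorm : ∑ s, star (V s 0) * V s 0 = 1 := by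
    have := congrFun (congrFun hV 0) 0
    simpa [Matrix.mul_apply] using this
  obtain ⟨b, hb⟩ := Orthonormal.exists_orthonormalBasis_extension_of_card_eq (𝕜 := ℂ) hcard
    (v := v) (s := {⟨0, rfl⟩}) (by
      rw [orthonormal_iff_ite]
      intro i j
      rw [if_pos (Subsingleton.elim i j)]
      simp only [Set.domRestrict_apply, hv, EuclideanSpace.inner_eq_star_dotProduct]
      rw [← hnorm, hsum _ fun s hs => hZ s 0 (right_ne_zero_of_mul hs)]
      exact Finset.sum_congr rfl fun s _ => mul_comm _ _)
  refine ⟨fun a s => if h : a q₀ = 0 ∧ wZ ⬝ᵥ s = 0 then b ⟨a, h.1⟩ ⟨s, h.2⟩ else 0,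
    fun s => ?_, fun a s h => ?_, fun a a' ha ha' => ?_⟩
  · by_cases hs : wZ ⬝ᵥ s = 0
    · simp only [hs, Pi.zero_apply, and_self, dite_true]
      have := hb ⟨0, rfl⟩ rfl
      rw [this]
    · simp only [hs, and_false, dite_false]
      by_contra h
      exact hs (hZ s 0 (Ne.symm h))
  · by_contra h'
    exact h (dif_neg fun h'' => h' h''.2)
  · have h := (orthonormal_iff_ite.1 b.orthonormal) ⟨a, ha⟩ ⟨a', ha'⟩
    rw [hsum _ fun s hs => ?_]
    · simp only [Subtype.mk.injEq] at h
      rw [← h, EuclideanSpace.inner_eq_star_dotProduct, dotProduct]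
      refine Finset.sum_congr rfl fun s _ => ?_
      simp [ha, ha', s.2, mul_comm]
    · by_contra h'
      exact hs (by simp [h'])

/-- A unitary that maps the physical qubit `q₀`, with the other qubits as ancillas in the state
`|0⟩`, to the encoded qubit, and its Pauli operators to the logical ones. -/
lemma exists_unitary_encoding {V : Matrix (Reg β) (ZMod 2) ℂ} {w : XZ → Reg β}
    (hw : w XZ.X ⬝ᵥ w XZ.Z = 1) (hV : Vᴴ * V = 1)
    (hX : ∀ s b a, V (s + a • w XZ.X) (b + a) = V s b)
    (hZ : ∀ s b, V s b ≠ 0 → w XZ.Z ⬝ᵥ s = b) (q₀ : β) :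
    ∃ E ∈ Matrix.unitaryGroup (Reg β) ℂ,
      (∀ P : XZ, E * tensorOp (fun q => if q = q₀ then pauli P else 1) * Eᴴ =
        tensorOp fun q => pauli (if w P q = 1 then P else XZ.I)) ∧
      ∀ s b, E s (Pi.single q₀ b) = V s b := by
  rw [dotProduct_comm] at hw
  obtain ⟨u, hu0, huZ, hu⟩ := exists_ancilla_basis hw hV hZ q₀
  -- the bit of the qubit `q₀` is encoded, the other bits are the label of a basis state
  set E : Op β := Matrix.of fun s t =>
    u (Function.update t q₀ 0) (s - t q₀ • w XZ.X) with hE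
  have hEZ : ∀ s t, E s t ≠ 0 → w XZ.Z ⬝ᵥ s = t q₀ := by
    intro s t h
    have := huZ _ _ h
    rw [dotProduct_sub, dotProduct_smul, hw, sub_eq_zero] at this
    simpa using this
  have hEE : Eᴴ * E = 1 := by
    ext t t'
    rw [Matrix.mul_apply, Matrix.one_apply]
    simp only [Matrix.conjTranspose_apply]
    by_cases ht : t q₀ = t' q₀
    · rw [← Equiv.sum_comp (Equiv.addRight (t q₀ • w XZ.X))]
      simp only [hE, Matrix.of_apply, Equiv.coe_addRight, add_sub_cancel_right, ← ht]
      rw [hu _ _ (by simp) (by simp)]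
      refine if_congr ⟨fun h => ?_, fun h => by rw [h]⟩ rfl rfl
      funext q
      by_cases hq : q = q₀
      · rw [hq, ht]
      · simpa [hq] using congrFun h q
    · rw [if_neg fun h => ht (by rw [h])]
      refine Finset.sum_eq_zero fun s _ => ?_
      by_contra h
      have h1 : E s t ≠ 0 := fun h0 => h (by simp [h0])
      exact ht ((hEZ s t h1).symm.trans (hEZ s t' (right_ne_zero_of_mul h)))
  have hEE' : E * Eᴴ = 1 := mul_eq_one_comm.1 hEE
  have hone : ∀ P, tensorOp (fun q => if q = q₀ then pauli P else 1) =
      tensorOp fun q => pauli (if (Pi.single q₀ 1 : Reg β) q = 1 then P else XZ.I) := by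
    intro P
    congr 1
    funext q
    by_cases hq : q = q₀
    · subst hq; simp
    · simp [hq, pauli]
  refine ⟨E, ?_, fun P => ?_, fun s b => ?_⟩
  · rw [Matrix.mem_unitaryGroup_iff]
    exact hEE'
  · have key : E * tensorOp (fun q => if q = q₀ then pauli P else 1) =
        tensorOp (fun q => pauli (if w P q = 1 then P else XZ.I)) * E := by
      rw [hone]
      cases P
      · simp [pauli, tensorOp_one]
      · ext s t
        simp only [Matrix.mul_apply, tensorOp_pauli_X_apply, mul_ite, mul_one, mul_zero,
          ite_mul, one_mul, zero_mul, Finset.sum_ite_eq', Finset.mem_univ, if_true]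
        simp only [eq_add_iff_add_eq, Finset.sum_ite_eq, Finset.mem_univ, if_true, hE, Matrix.of_apply]
        congr 1
        · funext q
          by_cases hq : q = q₀
          · subst hq; simp
          · simp [hq]
        · funext q
          simp only [Pi.sub_apply, Pi.add_apply, Pi.smul_apply, Pi.single_eq_same, smul_eq_mul,
            CharTwo.sub_eq_add]
          ring
      · ext s t
        simp only [Matrix.mul_apply, tensorOp_pauli_Z_apply, mul_ite, mul_zero,
          ite_mul, zero_mul, Finset.sum_ite_eq, Finset.sum_ite_eq', Finset.mem_univ, if_true]
        by_cases h : E s t = 0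
        · simp [h]
        · rw [hEZ s t h]
          simp [mul_comm]
    rw [key, Matrix.mul_assoc, hEE', Matrix.mul_one]
  · have h1 : Function.update (Pi.single q₀ b : Reg β) q₀ 0 = 0 := by
      funext q
      by_cases hq : q = q₀
      · subst hq; simp
      · simp [hq]
    simp only [hE, Matrix.of_apply, h1, Pi.single_eq_same, hu0]
    rw [← hX _ 0 b, sub_add_cancel, zero_add]

lemma blockPow_conj (n : ℕ) (E : Op β) (A : Fin n × β → QubitOp) :
    blockPow n E * tensorOp A * (blockPow n E)ᴴ =
      (piTensor fun i => E * tensorOp (fun q => A (i, q)) * Eᴴ).submatrix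
        (regEquiv (Equiv.refl _)) (regEquiv (Equiv.refl _)) := by
  rw [blockPow_eq, tensorOp_eq_submatrix (Equiv.refl _) A, Matrix.conjTranspose_submatrix,
    Matrix.submatrix_mul_equiv, Matrix.submatrix_mul_equiv, piTensor_conjTranspose, piTensor_mul,
    piTensor_mul]
  rfl

lemma blockPow_mem_unitaryGroup (n : ℕ) {E : Op β} (hE : E ∈ Matrix.unitaryGroup (Reg β) ℂ) :
    blockPow n E ∈ Matrix.unitaryGroup (Reg (Fin n × β)) ℂ := by
  rw [Matrix.mem_unitaryGroup_iff, Matrix.star_eq_conjTranspose] at hE ⊢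
  have := blockPow_conj n E fun _ => 1
  rw [tensorOp_one, Matrix.mul_one] at this
  rw [this]
  simp only [tensorOp_one, Matrix.mul_one, hE, piTensor_one, Matrix.submatrix_one_equiv]

lemma blockPow_mulVec_withAncilla (n : ℕ) (E : Op β) {V : Matrix (Reg β) (ZMod 2) ℂ} {q₀ : β}
    (hEV : ∀ s b, E s (Pi.single q₀ b) = V s b) (ψ : Reg (Fin n) → ℂ) :
    blockPow n E *ᵥ withAncilla q₀ ψ =
      (piTensor fun _ : Fin n => V).submatrix (regEquiv (Equiv.refl (Fin n × β))) id *ᵥ ψ := by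
  classical
  have hinj : Function.Injective fun (x : Reg (Fin n)) (p : Fin n × β) =>
      (Pi.single q₀ (x p.1) : Reg β) p.2 := by
    intro x y h
    funext i
    simpa using congrFun h (i, q₀)
  funext s
  simp only [Matrix.mulVec, dotProduct, withAncilla, mul_ite, mul_zero]
  rw [← Finset.sum_filter]
  symm
  refine Finset.sum_bij (fun x _ => fun p => (Pi.single q₀ (x p.1) : Reg β) p.2)
    (fun x _ => ?_) (fun x _ y _ h => hinj h) (fun t ht => ?_) (fun x _ => ?_)
  · simp only [Finset.mem_filter, Finset.mem_univ, true_and]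
    intro i q hq
    simp [hq]
  · refine ⟨fun i => t (i, q₀), Finset.mem_univ _, ?_⟩
    funext ⟨i, q⟩
    by_cases hq : q = q₀
    · subst hq; simp
    · simpa [hq] using ((Finset.mem_filter.1 ht).2 i q hq).symm
  · simp only [Pi.single_eq_same]
    congr 1
    simp only [blockPow, Matrix.of_apply, Matrix.submatrix_apply, piTensor_apply, id]
    exact Finset.prod_congr rfl fun i _ => (hEV _ _).symm

end Unitary

/-! ### Suppression of the logical error -/

section Faults

variable {m : ℕ} {Q : CSSCode m}

/-- If a measurement of the sub-blocks is faulty on at most one sub-block `j`, then the decoded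
outcome is not affected. Here `V` encodes a sub-block, `F i` are the effects of the measurement of
the sub-block `i`, and `c i` is their weight. -/
lemma sum_piTensor_mul_enc_of_single_fault {D : Q.Decoder} (hD : D.CorrectsSingleErrors) {P : XZ}
    (hP : P ≠ XZ.I) {R : Type} [Fintype R] {V : Matrix R (ZMod 2) ℂ}
    {F : Fin m → ZMod 2 → Matrix R R ℂ} {c : Fin m → ℂ} (j : Fin m)
    (hF : ∀ i, (∑ y, F i y) * V = c i • V)
    (hFj : ∀ i, i ≠ j → ∀ y, F i y * V = c i • (V * effect P y)) (v : ZMod 2) :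
    (∑ y, if D.levelBit P y = v then piTensor (fun i => F i (y i)) else 0) *
        (piTensor (fun _ : Fin m => V) * Q.enc : Matrix (Fin m → R) (ZMod 2) ℂ) =
      (∏ i, c i) •
        ((piTensor (fun _ : Fin m => V) * Q.enc : Matrix (Fin m → R) (ZMod 2) ℂ) * effect P v) := by
  -- on an ideal outcome `u` in the code, all outcomes `y` that differ from `u` in the place `j` only
  -- are decoded as `u` is
  have h1 : ∀ u : Reg (Fin m), u ∈ Q.outcomeCode P →
      (∑ y, if D.levelBit P y = v then piTensor (fun i => F i (y i)) else 0) *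
        (piTensor (fun _ : Fin m => V) * tensorOp fun i => effect P (u i)) =
      (∏ i, c i) • (piTensor (fun _ : Fin m => V) *
        (if D.levelBit P u = v then tensorOp (fun i => effect P (u i)) else 0 : Op (Fin m))) := by
    intro u hu
    have h2 : ∀ y : Reg (Fin m), (if D.levelBit P y = v then piTensor (fun i => F i (y i)) else 0) *
        (piTensor (fun _ : Fin m => V) * tensorOp fun i => effect P (u i)) =
        if D.levelBit P u = v then piTensor (fun i => F i (y i) * (V * effect P (u i))) else 0 := by
      intro y
      rw [tensorOp_eq_piTensor, piTensor_mul]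
      by_cases hy : ∀ i, i ≠ j → y i = u i
      · rw [levelBit_of_single_error hD hP hu hy,
          levelBit_of_single_error hD hP hu (y := u) (j := j) fun _ _ => rfl]
        split_ifs
        · rw [piTensor_mul]
        · rw [Matrix.zero_mul]
      · push Not at hy
        obtain ⟨i, hij, hi⟩ := hy
        have hz : F i (y i) * (V * effect P (u i)) = 0 := by
          rw [← Matrix.mul_assoc, hFj i hij, Matrix.smul_mul, Matrix.mul_assoc,
            effect_mul_of_ne P hi, Matrix.mul_zero, smul_zero]
        have hz' : piTensor (fun i => F i (y i) * (V * effect P (u i))) = 0 :=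
          piTensor_eq_zero (i := i) hz
        rw [hz', ite_self]
        split_ifs
        · rw [piTensor_mul, hz']
        · rw [Matrix.zero_mul]
    rw [Matrix.sum_mul]
    simp only [h2]
    split_ifs
    · rw [← piTensor_sum fun i y => F i y * (V * effect P (u i))]
      have h3 : ∀ i, ∑ y, F i y * (V * effect P (u i)) = c i • (V * effect P (u i)) := by
        intro i
        rw [← Matrix.sum_mul, ← Matrix.mul_assoc, hF, Matrix.smul_mul]
      simp only [h3]
      rw [piTensor_smul, tensorOp_eq_piTensor, piTensor_mul]
    · simp
  have h4 : Q.enc = ∑ u : Reg (Fin m), tensorOp (fun i => effect P (u i)) * Q.enc := by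
    rw [← Matrix.sum_mul, sum_tensorOp_effect, Matrix.one_mul]
  rw [Matrix.mul_assoc _ Q.enc, ← decodedEffect_mul_enc hD hP v, decodedEffect]
  conv_lhs => rw [h4]
  rw [Matrix.mul_sum, Matrix.mul_sum, Matrix.sum_mul, Matrix.mul_sum, Finset.smul_sum]
  refine Finset.sum_congr rfl fun u _ => ?_
  by_cases hu : u ∈ Q.outcomeCode P
  · rw [← Matrix.mul_assoc (piTensor _), ← Matrix.mul_assoc, h1 u hu, Matrix.smul_mul,
      Matrix.mul_assoc]
  · rw [effect_mul_enc_eq_zero hP hu]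
    split_ifs
    · rw [effect_mul_enc_eq_zero hP hu]; simp
    · simp

lemma sum_card_le_one {ι : Type} [Fintype ι] [DecidableEq ι] (f : ℕ → ℝ) :
    ∑ T ∈ Finset.univ.filter (fun T : Finset ι => T.card ≤ 1), f T.card =
      f 0 + Fintype.card ι * f 1 := by
  have h : Finset.univ.filter (fun T : Finset ι => T.card ≤ 1) =
      Finset.powersetCard 0 Finset.univ ∪ Finset.powersetCard 1 Finset.univ := by
    ext T
    simp only [Finset.mem_filter, Finset.mem_univ, true_and, Finset.mem_union,
      Finset.mem_powersetCard, Finset.subset_univ]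
    omega
  rw [h, Finset.sum_union (Finset.pairwise_disjoint_powersetCard _ (by simp))]
  rw [Finset.sum_congr rfl fun T hT => by rw [(Finset.mem_powersetCard.1 hT).2],
    Finset.sum_congr (s₁ := Finset.powersetCard 1 _) rfl
      fun T hT => by rw [(Finset.mem_powersetCard.1 hT).2]]
  simp

/-- The effects of the noisy measurement of one qubit. -/
noncomputable def noisyEffect {r : ℕ} (ε : ℝ) (K : Fin r → QubitOp) (P : XZ) (v : ZMod 2) : QubitOp :=
  ∑ j, (noiseKraus ε K j)ᴴ * effect P v * noiseKraus ε K j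

/-- The part of `noisyEffect` that is due to the noise. -/
noncomputable def faultEffect {r : ℕ} (K : Fin r → QubitOp) (P : XZ) (v : ZMod 2) : QubitOp :=
  ∑ j, (K j)ᴴ * effect P v * K j

lemma noisyEffect_eq {r : ℕ} {ε : ℝ} (h0 : 0 ≤ ε) (h1 : ε ≤ 1) (K : Fin r → QubitOp) (P : XZ)
    (v : ZMod 2) : noisyEffect ε K P v =
      ((1 - ε : ℝ) : ℂ) • effect P v + (ε : ℂ) • faultEffect K P v := by
  have hs : ∀ x : ℝ, 0 ≤ x → ∀ A : QubitOp, ((Real.sqrt x : ℂ)) • ((Real.sqrt x : ℂ)) • A =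
      (x : ℂ) • A := by
    intro x hx A
    rw [smul_smul, ← Complex.ofReal_mul, Real.mul_self_sqrt hx]
  simp only [noisyEffect, faultEffect, Fintype.sum_option, noiseKraus, Matrix.conjTranspose_smul,
    Matrix.conjTranspose_one, Matrix.smul_mul, Matrix.mul_smul, Matrix.one_mul, Matrix.mul_one,
    Complex.star_def, Complex.conj_ofReal, hs _ h0, hs _ (sub_nonneg.2 h1), Finset.smul_sum]

lemma sum_faultEffect {r : ℕ} {K : Fin r → QubitOp} (hK : IsKraus K) (P : XZ) :
    ∑ v, faultEffect K P v = 1 := by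
  simp only [faultEffect]
  rw [Finset.sum_comm]
  simp only [← Matrix.sum_mul, ← Matrix.mul_sum, sum_effect, Matrix.mul_one]
  exact hK

lemma faultEffect_posSemidef {r : ℕ} (K : Fin r → QubitOp) (P : XZ) (v : ZMod 2) :
    (faultEffect K P v).PosSemidef :=
  Matrix.posSemidef_sum _ fun j _ => (effect_posSemidef P v).conjTranspose_mul_mul_same (K j)

lemma sum_noisyEffect {r : ℕ} {ε : ℝ} (h0 : 0 ≤ ε) (h1 : ε ≤ 1) {K : Fin r → QubitOp}
    (hK : IsKraus K) (P : XZ) : ∑ v, noisyEffect ε K P v = 1 := by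
  simp only [noisyEffect_eq h0 h1, Finset.sum_add_distrib, ← Finset.smul_sum, sum_effect,
    sum_faultEffect hK, ← add_smul]
  simp

lemma ofReal_smul_posSemidef {R : Type} [Fintype R] {A : Matrix R R ℂ} (hA : A.PosSemidef) {x : ℝ}
    (hx : 0 ≤ x) : ((x : ℂ) • A).PosSemidef :=
  hA.smul (by exact_mod_cast hx)

/-- The decoded effects `F` of the noisy measurement of a block split into a part `G` that acts
on code states as the ideal measurement does, of weight `1 - q`, and a part `B` of weight `q`. -/
structure IsFaultSplitting (Q : CSSCode m) (k : ℕ) (P : XZ) (q : ℝ)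
    (F G B : ZMod 2 → Op (Block m k)) : Prop where
  eq_add : ∀ v, F v = G v + B v
  good_pos : ∀ v, (G v).PosSemidef
  bad_pos : ∀ v, (B v).PosSemidef
  sum_good : ∑ v, G v = ((1 - q : ℝ) : ℂ) • 1
  sum_bad : ∑ v, B v = (q : ℂ) • 1
  good_mul : ∀ v, G v * Q.concatEnc k = ((1 - q : ℝ) : ℂ) • (Q.concatEnc k * effect P v)

lemma smul_submatrix {R S R' S' : Type} (x : ℂ) (A : Matrix R S ℂ) (f : R' → R) (g : S' → S) :
    (x • A).submatrix f g = x • A.submatrix f g := rfl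

lemma isFaultSplitting_zero {r : ℕ} {ε : ℝ} (h0 : 0 ≤ ε) (h1 : ε ≤ 1) {K : Fin r → QubitOp}
    (hK : IsKraus K) (d : Reg (Fin m) → ZMod 2) (P : XZ) : ∃ G B,
    IsFaultSplitting Q 0 P ε (decodedEffect (concatDecode d 0) (noisyEffect ε K P)) G B := by
  set f := Equiv.funUnique (Block m 0) (ZMod 2) with hf
  have hsum : ∀ g : ZMod 2 → QubitOp, ∑ v, (g v).submatrix f f = (∑ v, g v).submatrix f f := by
    intro g
    ext s t
    simp [Matrix.sum_apply]
  refine ⟨fun v => (((1 - ε : ℝ) : ℂ) • effect P v).submatrix f f,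
    fun v => ((ε : ℂ) • faultEffect K P v).submatrix f f, fun v => ?_, fun v => ?_, fun v => ?_,
    ?_, ?_, fun v => ?_⟩
  · rw [decodedEffect_concatDecode_zero, noisyEffect_eq h0 h1]
    rfl
  · exact (ofReal_smul_posSemidef (effect_posSemidef P v) (sub_nonneg.2 h1)).submatrix _
  · exact (ofReal_smul_posSemidef (faultEffect_posSemidef K P v) h0).submatrix _
  · rw [hsum, ← Finset.smul_sum, sum_effect, smul_submatrix, Matrix.submatrix_one_equiv]
  · rw [hsum, ← Finset.smul_sum, sum_faultEffect hK, smul_submatrix, Matrix.submatrix_one_equiv]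
  · rw [concatEnc_zero_eq, Matrix.submatrix_mul_equiv, submatrix_mul_left, Matrix.mul_one,
      Matrix.one_mul]
    rfl

/-- The probability that at least two of `m` independent events of probability `q` occur. -/
def twoFaultProb (m : ℕ) (q : ℝ) : ℝ := 1 - ((1 - q) ^ m + m * (q * (1 - q) ^ (m - 1)))

lemma twoFaultProb_le (hm : 0 < m) {q : ℝ} (h0 : 0 ≤ q) (h1 : q ≤ 1) :
    twoFaultProb m q ≤ (m : ℝ) ^ 2 * q ^ 2 := by
  obtain ⟨n, rfl⟩ : ∃ n, m = n + 1 := ⟨m - 1, by omega⟩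
  have hB : 1 + (n : ℝ) * (-q) ≤ (1 + -q) ^ n := one_add_mul_le_pow (by linarith) n
  have hn : (0 : ℝ) ≤ n := n.cast_nonneg
  have h2 := mul_le_mul_of_nonneg_right hB (by positivity : 0 ≤ 1 + n * q)
  simp only [twoFaultProb, Nat.add_sub_cancel, Nat.cast_add, Nat.cast_one]
  have h3 : (1 - q) ^ (n + 1) + (n + 1) * (q * (1 - q) ^ n) = (1 + -q) ^ n * (1 + n * q) := by
    rw [← sub_eq_add_neg]; ring
  rw [h3]
  nlinarith [mul_nonneg hn (sq_nonneg q), sq_nonneg q]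

lemma isFaultSplitting_succ {D : Q.Decoder} (hD : D.CorrectsSingleErrors) {P : XZ}
    (hP : P ≠ XZ.I) (hm : 0 < m) {k : ℕ} {f : ZMod 2 → QubitOp} (hf : ∑ v, f v = 1) {q : ℝ}
    {G B : ZMod 2 → Op (Block m k)}
    (h : IsFaultSplitting Q k P q (decodedEffect (concatDecode (D.levelBit P) k) f) G B) :
    ∃ G' B', IsFaultSplitting Q (k + 1) P (twoFaultProb m q)
      (decodedEffect (concatDecode (D.levelBit P) (k + 1)) f) G' B' := by
  set e := regEquiv (blockEquiv m k) with he
  -- the faulty sub-blocks are those in `T`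
  set A : Finset (Fin m) → ZMod 2 → Matrix (Fin m → Reg (Block m k)) (Fin m → Reg (Block m k)) ℂ :=
    fun T v => ∑ y : Reg (Fin m), if D.levelBit P y = v then
      piTensor (fun i => if i ∈ T then B (y i) else G (y i)) else 0 with hA
  set c : Finset (Fin m) → Fin m → ℂ := fun T i => if i ∈ T then (q : ℂ) else ((1 - q : ℝ) : ℂ)
    with hc
  have hcard : ∀ T, ∏ i, c T i = ((q ^ T.card * (1 - q) ^ (m - T.card) : ℝ) : ℂ) := by
    intro T
    simp only [hc]
    rw [Finset.prod_ite, Finset.prod_const, Finset.prod_const, Finset.filter_mem_eq_inter,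
      Finset.univ_inter, Finset.filter_not, Finset.filter_mem_eq_inter, Finset.univ_inter,
      ← Finset.compl_eq_univ_sdiff, Finset.card_compl, Fintype.card_fin]
    push_cast
    rfl
  have hprob : ∑ T ∈ Finset.univ.filter (fun T : Finset (Fin m) => T.card ≤ 1), ∏ i, c T i =
      ((1 - twoFaultProb m q : ℝ) : ℂ) := by
    simp only [hcard]
    rw [← Complex.ofReal_sum, sum_card_le_one (ι := Fin m) fun j => q ^ j * (1 - q) ^ (m - j)]
    simp [twoFaultProb]
  have hsum : ∀ T, ∑ v, A T v = (∏ i, c T i) • 1 := by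
    intro T
    simp only [hA]
    rw [Finset.sum_comm]
    simp only [Finset.sum_ite_eq, Finset.mem_univ, if_true]
    rw [← piTensor_sum fun i y => if i ∈ T then B y else G y]
    have : ∀ i, ∑ y, (if i ∈ T then B y else G y) = c T i • (1 : Op (Block m k)) := by
      intro i
      simp only [hc]
      split_ifs
      · exact h.sum_bad
      · exact h.sum_good
    simp only [this]
    rw [piTensor_smul, piTensor_one]
  have hpos : ∀ T v, (A T v).PosSemidef := by
    intro T v
    refine Matrix.posSemidef_sum _ fun y _ => ?_
    split_ifs
    · refine piTensor_posSemidef fun i => ?_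
      split_ifs
      · exact h.bad_pos _
      · exact h.good_pos _
    · exact Matrix.PosSemidef.zero
  have hF : ∀ v, decodedEffect (concatDecode (D.levelBit P) (k + 1)) f v =
      (∑ T, A T v).submatrix e e := by
    intro v
    rw [concatDecode_succ, decodedEffect_blocks (blockEquiv m k)]
    congr 1
    simp only [hA]
    rw [Finset.sum_comm]
    refine Finset.sum_congr rfl fun y _ => ?_
    split_ifs
    · rw [← piTensor_add]
      congr 1
      funext i
      rw [h.eq_add, add_comm]
    · simp
  have hsub : ∀ g : ZMod 2 → Matrix (Fin m → Reg (Block m k)) (Fin m → Reg (Block m k)) ℂ,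
      ∑ v, (g v).submatrix e e = (∑ v, g v).submatrix e e := by
    intro g
    ext s t
    simp [Matrix.sum_apply]
  have hgood : ∑ v, (∑ T ∈ Finset.univ.filter (fun T : Finset (Fin m) => T.card ≤ 1),
      A T v).submatrix e e = ((1 - twoFaultProb m q : ℝ) : ℂ) • 1 := by
    rw [hsub, Finset.sum_comm]
    simp only [hsum]
    rw [← Finset.sum_smul, hprob, smul_submatrix, Matrix.submatrix_one_equiv]
  have hadd : ∀ v, decodedEffect (concatDecode (D.levelBit P) (k + 1)) f v =
      (∑ T ∈ Finset.univ.filter (fun T : Finset (Fin m) => T.card ≤ 1), A T v).submatrix e e +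
      (∑ T ∈ Finset.univ.filter (fun T : Finset (Fin m) => ¬ T.card ≤ 1),
        A T v).submatrix e e := by
    intro v
    rw [hF, ← Finset.sum_filter_add_sum_filter_not Finset.univ
      (fun T : Finset (Fin m) => T.card ≤ 1)]
    rfl
  refine ⟨_, _, hadd, fun v => ?_, fun v => ?_, hgood, ?_, fun v => ?_⟩
  · exact (Matrix.posSemidef_sum _ fun T _ => hpos T v).submatrix _
  · exact (Matrix.posSemidef_sum _ fun T _ => hpos T v).submatrix _
  · have h1 := sum_decodedEffect (concatDecode (D.levelBit P) (k + 1)) hf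
    simp only [hadd, Finset.sum_add_distrib, hgood] at h1
    rw [eq_sub_of_add_eq' h1]
    push_cast
    module
  · rw [concatEnc_succ, Matrix.submatrix_mul_equiv, submatrix_mul_left, ← smul_submatrix,
      Matrix.sum_mul, ← hprob, Finset.sum_smul]
    congr 1
    refine Finset.sum_congr rfl fun T hT => ?_
    obtain ⟨j, hj⟩ : ∃ j, T ⊆ {j} := by
      have hT1 : T.card ≤ 1 := (Finset.mem_filter.1 hT).2
      rcases T.eq_empty_or_nonempty with rfl | ⟨j, hj⟩
      · exact ⟨⟨0, hm⟩, Finset.empty_subset _⟩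
      · exact ⟨j, fun i hi => Finset.mem_singleton.2 (Finset.card_le_one.1 hT1 i hi j hj)⟩
    refine sum_piTensor_mul_enc_of_single_fault (F := fun i y => if i ∈ T then B y else G y)
      (c := c T) hD hP j (fun i => ?_) (fun i hij y => ?_) v
    · simp only [hc]
      split_ifs
      · rw [h.sum_bad, Matrix.smul_mul, Matrix.one_mul]
      · rw [h.sum_good, Matrix.smul_mul, Matrix.one_mul]
    · have hiT : i ∉ T := fun hi => hij (Finset.mem_singleton.1 (hj hi))
      simp only [hc, if_neg hiT]
      exact h.good_mul y

lemma code_length_pos (Q : CSSCode m) : 0 < m := by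
  rcases Nat.eq_zero_or_pos m with rfl | h
  · have := Q.lX_dot_lZ
    simp [dotProduct] at this
  · exact h

/-- The weight of the uncorrected faults after `k` levels: it is squared, up to a factor, by each
level. -/
lemma exists_faultSplitting {D : Q.Decoder} (hD : D.CorrectsSingleErrors) {P : XZ}
    (hP : P ≠ XZ.I) {r : ℕ} {ε : ℝ} (h0 : 0 ≤ ε) (h1 : ε ≤ 1) {K : Fin r → QubitOp}
    (hK : IsKraus K) (k : ℕ) : ∃ q : ℝ, 0 ≤ q ∧ q ≤ 1 ∧
      q ≤ ((m : ℝ) ^ 2) ^ (2 ^ k - 1) * ε ^ 2 ^ k ∧ ∃ G B, IsFaultSplitting Q k P q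
        (decodedEffect (concatDecode (D.levelBit P) k) (noisyEffect ε K P)) G B := by
  induction k with
  | zero => exact ⟨ε, h0, h1, by simp, isFaultSplitting_zero h0 h1 hK _ P⟩
  | succ k ih =>
    obtain ⟨q, hq0, hq1, hq, G, B, hGB⟩ := ih
    have hle := twoFaultProb_le (code_length_pos Q) hq0 hq1
    obtain ⟨G', B', hGB'⟩ :=
      isFaultSplitting_succ hD hP (code_length_pos Q) (sum_noisyEffect h0 h1 hK P) hGB
    -- the weights are traces of positive operators
    have hw : ∀ {x : ℝ} {F : ZMod 2 → Op (Block m (k + 1))}, (∀ v, (F v).PosSemidef) →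
        ∑ v, F v = (x : ℂ) • 1 → 0 ≤ x := by
      intro x F hF hx
      have h2 := (Matrix.posSemidef_sum Finset.univ fun v _ => hF v).diag_nonneg (i := 0)
      rw [hx] at h2
      simpa using h2
    refine ⟨twoFaultProb m q, hw hGB'.bad_pos hGB'.sum_bad,
      sub_nonneg.1 (hw hGB'.good_pos hGB'.sum_good), hle.trans ?_, G', B', hGB'⟩
    have h3 : 2 ^ (k + 1) - 1 = (2 ^ k - 1) + (2 ^ k - 1) + 1 := by
      have := Nat.one_le_two_pow (n := k)
      omega
    calc (m : ℝ) ^ 2 * q ^ 2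
        ≤ (m : ℝ) ^ 2 * (((m : ℝ) ^ 2) ^ (2 ^ k - 1) * ε ^ 2 ^ k) ^ 2 := by gcongr
      _ = _ := by
        rw [h3, pow_succ 2 k, pow_mul ε, pow_succ _ (_ + _), pow_add]
        ring

end Faults

/-! ### Distributions of the decoded outcomes -/

section Prob

lemma trace_tensorOp_mul_iidChannel {κ ι : Type} [Fintype κ] [Fintype ι] [DecidableEq ι]
    (A : ι → QubitOp) (K : κ → QubitOp) (ρ : Op ι) :
    (tensorOp A * iidChannel K ρ).trace =
      (tensorOp (fun i => ∑ j, (K j)ᴴ * A i * K j) * ρ).trace := by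
  have h : tensorOp (fun i => ∑ j, (K j)ᴴ * A i * K j) =
      ∑ f : ι → κ, tensorOp fun i => (K (f i))ᴴ * A i * K (f i) :=
    piTensor_sum fun i j => (K j)ᴴ * A i * K j
  rw [h, iidChannel, Matrix.mul_sum, Matrix.sum_mul, Matrix.trace_sum, Matrix.trace_sum]
  refine Finset.sum_congr rfl fun f _ => ?_
  rw [← tensorOp_mul, ← tensorOp_mul, ← tensorOp_conjTranspose, ← Matrix.mul_assoc,
    Matrix.trace_mul_comm]
  simp only [Matrix.mul_assoc]

lemma outcomeProb_noise {r : ℕ} {ι : Type} [Fintype ι] [DecidableEq ι] (ε : ℝ)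
    (K : Fin r → QubitOp) (P : ι → XZ) (σ : Op ι) (s : Reg ι) :
    outcomeProb P (noise ε K σ) s =
      (tensorOp (fun i => noisyEffect ε K (P i) (s i)) * σ).trace.re := by
  rw [outcomeProb, noise, trace_tensorOp_mul_iidChannel]
  rfl

lemma IsState.noise {r : ℕ} {ι : Type} [Fintype ι] [DecidableEq ι] {ε : ℝ} (h0 : 0 ≤ ε)
    (h1 : ε ≤ 1) {K : Fin r → QubitOp} (hK : IsKraus K) {σ : Op ι} (hσ : IsState σ) :
    IsState (noise ε K σ) := by
  refine ⟨Matrix.posSemidef_sum _ fun f _ => hσ.1.mul_mul_conjTranspose_same _, ?_⟩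
  have h := trace_tensorOp_mul_iidChannel (fun _ : ι => 1) (noiseKraus ε K) σ
  have hI : ∑ j, (noiseKraus ε K j)ᴴ * 1 * noiseKraus ε K j = 1 := by
    have h2 := sum_noisyEffect h0 h1 hK XZ.I
    rw [sum_zmod_two] at h2
    simpa [noisyEffect, effect] using h2
  rw [hI, tensorOp_one, Matrix.one_mul, Matrix.one_mul] at h
  exact h.trans hσ.2

variable {m : ℕ} {Q : CSSCode m} {n k : ℕ}

/-- The tensor product of operators on the blocks of a physical register. -/
noncomputable def blockTensor (B : Fin n → Op (Block m k)) : Op (Fin n × Block m k) :=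
  (piTensor B).submatrix (regEquiv (Equiv.refl _)) (regEquiv (Equiv.refl _))

lemma sum_tensorOp_decode (D : Q.Decoder) (P : Fin n → XZ) (f : XZ → ZMod 2 → QubitOp)
    (y : Reg (Fin n)) :
    (∑ s : Reg (Fin n × Block m k),
      if (fun i => D.decode k (P i) fun q => s (i, q)) = y
        then tensorOp (fun p => f (P p.1) (s p)) else 0) =
      blockTensor fun i => decodedEffect (D.decode k (P i)) (f (P i)) (y i) := by
  rw [blockTensor, piTensor_decodedEffect (fun i => D.decode k (P i)) fun i => f (P i),
    ← Equiv.sum_comp (regEquiv (Equiv.refl (Fin n × Block m k)))]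
  ext s t
  rw [Matrix.submatrix_apply, Matrix.sum_apply, Matrix.sum_apply]
  refine Finset.sum_congr rfl fun u _ => ?_
  have : (fun i => D.decode k (P i) (regEquiv (Equiv.refl (Fin n × Block m k)) u i)) =
    fun i => D.decode k (P i) fun q => u (i, q) := rfl
  rw [this]
  split_ifs
  · rw [tensorOp_eq_submatrix (Equiv.refl (Fin n × Block m k))]; rfl
  · rfl

lemma decodedProb_eq_of_outcomeProb (D : Q.Decoder) (P : Fin n → XZ) (f : XZ → ZMod 2 → QubitOp)
    {σ σ' : Op (Fin n × Block m k)}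
    (h : ∀ s, outcomeProb (fun p => P p.1) σ' s =
      (tensorOp (fun p => f (P p.1) (s p)) * σ).trace.re) (y : Reg (Fin n)) :
    D.decodedProb P σ' y =
      ((blockTensor fun i => decodedEffect (D.decode k (P i)) (f (P i)) (y i)) * σ).trace.re := by
  rw [← sum_tensorOp_decode, Matrix.sum_mul, Matrix.trace_sum, Complex.re_sum,
    CSSCode.Decoder.decodedProb]
  refine Finset.sum_congr rfl fun s _ => ?_
  split_ifs
  · exact h s
  · simp

lemma decodedProb_eq (D : Q.Decoder) (P : Fin n → XZ) (σ : Op (Fin n × Block m k))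
    (y : Reg (Fin n)) : D.decodedProb P σ y =
      ((blockTensor fun i => decodedEffect (D.decode k (P i)) (effect (P i)) (y i)) * σ).trace.re :=
  decodedProb_eq_of_outcomeProb D P effect (fun _ => rfl) y

lemma decodedProb_noise_eq (D : Q.Decoder) {r : ℕ} (ε : ℝ) (K : Fin r → QubitOp) (P : Fin n → XZ)
    (σ : Op (Fin n × Block m k)) (y : Reg (Fin n)) : D.decodedProb P (noise ε K σ) y =
      ((blockTensor fun i =>
        decodedEffect (D.decode k (P i)) (noisyEffect ε K (P i)) (y i)) * σ).trace.re :=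
  decodedProb_eq_of_outcomeProb D P (noisyEffect ε K) (fun s => outcomeProb_noise ε K _ σ s) y

/-- Whatever the state of the physical qubits, its decoded outcomes in all bases are
distributed as the ideal outcomes of one and the same state of the logical qubits. -/
lemma exists_logical_state (D : Q.Decoder) {σ : Op (Fin n × Block m k)} (hσ : IsState σ) :
    ∃ ρ : Op (Fin n), IsState ρ ∧ ∀ P y, D.decodedProb P σ y = outcomeProb P ρ y := by
  obtain ⟨A, hA, W, hW⟩ := exists_kraus_decodedEffect D k
  set U : (Fin n → A) → Matrix (Reg (Fin n × Block m k)) (Reg (Fin n)) ℂ := fun a =>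
    (piTensor fun i => W (a i)).submatrix (regEquiv (Equiv.refl _)) id with hU
  have h1 : ∀ (P : Fin n → XZ) (y : Reg (Fin n)),
      (tensorOp (fun i => effect (P i) (y i)) * ∑ a, (U a)ᴴ * σ * U a).trace =
      ((blockTensor fun i => decodedEffect (D.decode k (P i)) (effect (P i)) (y i)) * σ).trace := by
    intro P y
    have h2 : (blockTensor fun i => decodedEffect (D.decode k (P i)) (effect (P i)) (y i)) =
        ∑ a, U a * tensorOp (fun i => effect (P i) (y i)) * (U a)ᴴ := by
      simp only [← hW, blockTensor]
      rw [piTensor_sum fun i a => W a * effect (P i) (y i) * (W a)ᴴ]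
      ext s t
      rw [Matrix.submatrix_apply, Matrix.sum_apply, Matrix.sum_apply]
      refine Finset.sum_congr rfl fun a _ => ?_
      simp only [hU]
      rw [submatrix_mul_left, Matrix.conjTranspose_submatrix, tensorOp_eq_piTensor,
        ← piTensor_mul, ← piTensor_mul, ← piTensor_conjTranspose]
      rfl
    rw [h2, Matrix.mul_sum, Matrix.sum_mul, Matrix.trace_sum, Matrix.trace_sum]
    refine Finset.sum_congr rfl fun a _ => ?_
    rw [← Matrix.mul_assoc, Matrix.trace_mul_comm]
    simp only [Matrix.mul_assoc]
  refine ⟨∑ a, (U a)ᴴ * σ * U a, ⟨?_, ?_⟩, fun P y => ?_⟩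
  · exact Matrix.posSemidef_sum _ fun a _ => hσ.1.conjTranspose_mul_mul_same _
  · have h3 := h1 (fun _ => XZ.I) 0
    have h4 : blockTensor (fun i : Fin n => decodedEffect (D.decode k XZ.I) (effect XZ.I)
        ((0 : Reg (Fin n)) i)) = 1 := by
      simp only [decode_I, decodedEffect_zero (sum_effect _), Pi.zero_apply, if_true]
      rw [blockTensor, piTensor_one, Matrix.submatrix_one_equiv]
    rw [h4, Matrix.one_mul, hσ.2] at h3
    rw [← h3]
    simp [effect, tensorOp_one]
  · rw [decodedProb_eq, outcomeProb, h1]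

lemma sum_outcomeProb {ι : Type} [Fintype ι] [DecidableEq ι] (P : ι → XZ) {ρ : Op ι}
    (hρ : IsState ρ) : ∑ y, outcomeProb P ρ y = 1 := by
  have h := piTensor_sum fun (i : ι) => effect (P i)
  simp only [sum_effect, piTensor_one] at h
  simp only [outcomeProb]
  rw [← Complex.re_sum, ← Matrix.trace_sum, ← Matrix.sum_mul]
  simp only [tensorOp_eq_piTensor]
  rw [← h, Matrix.one_mul, hρ.2, Complex.one_re]

lemma outcomeProb_nonneg {ι : Type} [Fintype ι] [DecidableEq ι] (P : ι → XZ) {ρ : Op ι}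
    (hρ : IsState ρ) (y : Reg ι) : 0 ≤ outcomeProb P ρ y :=
  (piTensor_posSemidef fun i => effect_posSemidef (P i) (y i)).trace_mul_re_nonneg hρ.1

lemma IsState.encState {ρ : Op (Fin n)} (hρ : IsState ρ) : IsState (Q.encState k ρ) := by
  refine ⟨hρ.1.mul_mul_conjTranspose_same _, ?_⟩
  rw [CSSCode.encState, Matrix.trace_mul_comm, ← Matrix.mul_assoc, encReg_isometry, Matrix.one_mul]
  exact hρ.2

lemma sum_decodedProb (D : Q.Decoder) (P : Fin n → XZ) {σ : Op (Fin n × Block m k)}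
    (hσ : IsState σ) : ∑ y, D.decodedProb P σ y = 1 := by
  obtain ⟨ρ, hρ, h⟩ := exists_logical_state D hσ
  simp only [h, sum_outcomeProb P hρ]

lemma trace_blockTensor_mul_encState (B : Fin n → Op (Block m k)) (ρ : Op (Fin n)) :
    (blockTensor B * Q.encState k ρ).trace =
      (piTensor (fun i => (Q.concatEnc k)ᴴ * B i * Q.concatEnc k) * ρ).trace := by
  have h : (Q.encReg n k)ᴴ * blockTensor B * Q.encReg n k =
      piTensor fun i => (Q.concatEnc k)ᴴ * B i * Q.concatEnc k := by
    rw [encReg_eq, blockTensor, Matrix.mul_assoc, Matrix.submatrix_mul_equiv, submatrix_isometry,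
      piTensor_mul, piTensor_conjTranspose, piTensor_mul]
    simp only [Matrix.mul_assoc]
  rw [← h, CSSCode.encState, ← Matrix.mul_assoc, Matrix.trace_mul_comm]
  simp only [Matrix.mul_assoc]

/-- The noisy measurement of an encoded qubit is, with probability `1 - q`, the ideal
measurement of the qubit. -/
lemma exists_noisy_splitting {D : Q.Decoder} (hD : D.CorrectsSingleErrors) {r : ℕ} {ε : ℝ}
    (h0 : 0 ≤ ε) (h1 : ε ≤ 1) {K : Fin r → QubitOp} (hK : IsKraus K) (k : ℕ) (P : XZ) :
    ∃ (q : ℝ) (B : ZMod 2 → QubitOp), 0 ≤ q ∧ q ≤ 1 ∧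
      q ≤ (if P = XZ.I then 0 else ((m : ℝ) ^ 2) ^ (2 ^ k - 1) * ε ^ 2 ^ k) ∧
      (∀ v, (B v).PosSemidef) ∧ ∀ v, (Q.concatEnc k)ᴴ *
        decodedEffect (D.decode k P) (noisyEffect ε K P) v * Q.concatEnc k =
          ((1 - q : ℝ) : ℂ) • effect P v + B v := by
  by_cases hP : P = XZ.I
  · subst hP
    refine ⟨0, 0, le_rfl, zero_le_one, by simp, fun v => Matrix.PosSemidef.zero, fun v => ?_⟩
    rw [decode_I, decodedEffect_zero (sum_noisyEffect h0 h1 hK _)]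
    simp only [effect]
    split_ifs
    · simp [concatEnc_isometry]
    · simp
  · obtain ⟨q, hq0, hq1, hq, G, B, h⟩ := exists_faultSplitting hD hP h0 h1 hK k
    refine ⟨q, fun v => (Q.concatEnc k)ᴴ * B v * Q.concatEnc k, hq0, hq1, by rwa [if_neg hP],
      fun v => (h.bad_pos v).conjTranspose_mul_mul_same _, fun v => ?_⟩
    rw [decode_eq D hP, h.eq_add, Matrix.mul_add, Matrix.add_mul, Matrix.mul_assoc _ (G v),
      h.good_mul, Matrix.mul_smul, ← Matrix.mul_assoc, concatEnc_isometry, Matrix.one_mul]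

lemma one_sub_prod_le {ι : Type} (s : Finset ι) {q : ι → ℝ} (h0 : ∀ i, 0 ≤ q i)
    (h1 : ∀ i, q i ≤ 1) : 1 - ∏ i ∈ s, (1 - q i) ≤ ∑ i ∈ s, q i := by
  classical
  induction s using Finset.induction with
  | empty => simp
  | insert a s ha ih =>
    rw [Finset.prod_insert ha, Finset.sum_insert ha]
    have h2 : ∏ i ∈ s, (1 - q i) ≤ 1 :=
      Finset.prod_le_one (fun i _ => sub_nonneg.2 (h1 i)) fun i _ => by linarith [h0 i]
    nlinarith [h0 a]

lemma decodedProb_noise_encState_tv {D : Q.Decoder} (hD : D.CorrectsSingleErrors) {r : ℕ} {ε : ℝ}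
    (h0 : 0 ≤ ε) (h1 : ε ≤ 1) {K : Fin r → QubitOp} (hK : IsKraus K) (k : ℕ) (P : Fin n → XZ)
    {ρ : Op (Fin n)} (hρ : IsState ρ) :
    (1 / 2 : ℝ) * ∑ y, |D.decodedProb P (noise ε K (Q.encState k ρ)) y - outcomeProb P ρ y| ≤
      (Finset.univ.filter fun i => P i ≠ XZ.I).card *
        (((m : ℝ) ^ 2) ^ (2 ^ k - 1) * ε ^ 2 ^ k) := by
  choose q B hq0 hq1 hq hB heq using exists_noisy_splitting hD h0 h1 hK k
  set c : ℝ := ∏ i, (1 - q (P i)) with hc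
  have hc0 : 0 ≤ c := Finset.prod_nonneg fun i _ => sub_nonneg.2 (hq1 _)
  have hc1 : c ≤ 1 := Finset.prod_le_one (fun i _ => sub_nonneg.2 (hq1 _))
    fun i _ => by linarith [hq0 (P i)]
  -- the ideal outcomes occur at least with the weight `c` of no uncorrected fault in any block
  have hle : ∀ y, c * outcomeProb P ρ y ≤ D.decodedProb P (noise ε K (Q.encState k ρ)) y := by
    intro y
    rw [decodedProb_noise_eq, trace_blockTensor_mul_encState]
    simp only [heq]
    rw [piTensor_add, ← Finset.add_sum_erase _ _ (Finset.mem_univ Finset.univ), Matrix.add_mul,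
      Matrix.trace_add, Complex.add_re]
    simp only [Finset.mem_univ, if_true]
    rw [piTensor_smul, Matrix.smul_mul, Matrix.trace_smul, ← Complex.ofReal_prod, smul_eq_mul,
      Complex.re_ofReal_mul]
    refine le_add_of_nonneg_right (Matrix.PosSemidef.trace_mul_re_nonneg
      (Matrix.posSemidef_sum _ fun T _ => piTensor_posSemidef fun i => ?_) hρ.1)
    split_ifs
    · exact ofReal_smul_posSemidef (effect_posSemidef _ _) (sub_nonneg.2 (hq1 _))
    · exact hB _ _
  have habs : ∀ y, |D.decodedProb P (noise ε K (Q.encState k ρ)) y - outcomeProb P ρ y| ≤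
      (D.decodedProb P (noise ε K (Q.encState k ρ)) y - c * outcomeProb P ρ y) +
        (1 - c) * outcomeProb P ρ y := by
    intro y
    have h2 := mul_nonneg (sub_nonneg.2 hc1) (outcomeProb_nonneg P hρ y)
    have h3 := hle y
    rw [abs_le]
    constructor <;> linarith
  have hsum := Finset.sum_le_sum fun y (_ : y ∈ Finset.univ) => habs y
  rw [Finset.sum_add_distrib, Finset.sum_sub_distrib, ← Finset.mul_sum, ← Finset.mul_sum,
    sum_decodedProb D P (hρ.encState.noise h0 h1 hK), sum_outcomeProb P hρ] at hsum
  have h4 := one_sub_prod_le Finset.univ (fun i => hq0 (P i)) fun i => hq1 (P i)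
  have h5 : ∑ i, q (P i) ≤ (Finset.univ.filter fun i => P i ≠ XZ.I).card *
      (((m : ℝ) ^ 2) ^ (2 ^ k - 1) * ε ^ 2 ^ k) := by
    rw [← nsmul_eq_mul, ← Finset.sum_const, Finset.sum_filter]
    refine Finset.sum_le_sum fun i _ => (hq (P i)).trans_eq ?_
    rw [ite_not]
  linarith

lemma sum_sub_le_half_sum_abs {Y : Type} [Fintype Y] {f g : Y → ℝ} (h : ∑ y, f y = ∑ y, g y)
    (p : Y → Prop) [DecidablePred p] :
    (∑ y, if p y then f y else 0) ≤ (∑ y, if p y then g y else 0) + 1 / 2 * ∑ y, |f y - g y| := by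
  have h1 : ∀ y, (if p y then f y else 0) - (if p y then g y else 0) ≤
      1 / 2 * |f y - g y| + 1 / 2 * (f y - g y) := by
    intro y
    split_ifs
    · linarith [le_abs_self (f y - g y)]
    · linarith [neg_abs_le (f y - g y)]
  have h2 := Finset.sum_le_sum fun y (_ : y ∈ Finset.univ) => h1 y
  rw [Finset.sum_sub_distrib, Finset.sum_add_distrib, ← Finset.mul_sum, ← Finset.mul_sum,
    Finset.sum_sub_distrib, h] at h2
  linarith

lemma trace_effect {P : XZ} (hP : P ≠ XZ.I) (v : ZMod 2) : (effect P v).trace = 1 := by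
  have h : (pauli P).trace = 0 := by
    cases P
    · exact absurd rfl hP
    · simp [Matrix.trace, pauli]
    · simp [Matrix.trace, sum_zmod_two, pauli]
  rw [effect_eq hP]
  simp [h]

/-- The outcome of the noisy measurement of an encoded eigenstate is wrong with small
probability. -/
lemma decodedProb_noise_eigenstate_le {D : Q.Decoder} (hD : D.CorrectsSingleErrors) {r : ℕ} {ε : ℝ}
    (h0 : 0 ≤ ε) (h1 : ε ≤ 1) {K : Fin r → QubitOp} (hK : IsKraus K) (k : ℕ) {P : XZ}
    (hP : P ≠ XZ.I) (v : ZMod 2) :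
    D.decodedProb (fun _ : Fin 1 => P)
      (noise ε K (Q.encState k (tensorOp fun _ : Fin 1 => effect P v))) (fun _ => v + 1) ≤
        ((m : ℝ) ^ 2) ^ (2 ^ k - 1) * ε ^ 2 ^ k := by
  have hρ : IsState (tensorOp fun _ : Fin 1 => effect P v) := by
    refine ⟨piTensor_posSemidef fun _ => effect_posSemidef P v, ?_⟩
    rw [← trace_effect hP v, Matrix.trace, Matrix.trace,
      ← Equiv.sum_comp (Equiv.funUnique (Fin 1) (ZMod 2)).symm]
    simp [tensorOp]
  have htv := decodedProb_noise_encState_tv hD h0 h1 hK k (fun _ : Fin 1 => P) hρ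
  have hs := sum_sub_le_half_sum_abs ((sum_decodedProb D (fun _ => P)
    ((hρ.encState (Q := Q) (k := k)).noise h0 h1 hK)).trans
      (sum_outcomeProb (fun _ => P) hρ).symm)
    (fun y => y = fun _ => v + 1)
  have hz : outcomeProb (fun _ : Fin 1 => P) (tensorOp fun _ : Fin 1 => effect P v)
      (fun _ => v + 1) = 0 := by
    rw [outcomeProb, tensorOp_mul, effect_mul_of_ne P (by simp), tensorOp_eq_piTensor,
      piTensor_eq_zero (i := 0) rfl]
    simp
  simp only [Finset.sum_ite_eq', Finset.mem_univ, if_true, hz, zero_add] at hs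
  refine hs.trans (htv.trans_eq ?_)
  simp [hP]

end Prob

/-! ### Acceptance probabilities -/

section Accept

variable {n : ℕ} (H : XZHamiltonian n)

lemma sum_abs_coeff_div (hH : 0 < H.norm1) : ∑ i, |H.coeff i| / H.norm1 = 1 := by
  rw [← Finset.sum_div]
  exact div_self hH.ne'

lemma acceptProb_le_add (hH : 0 < H.norm1) {pr pr' : (Fin n → XZ) → Reg (Fin n) → ℝ} {η : ℝ}
    (h : ∀ i (p : Reg (Fin n) → Prop) [DecidablePred p],
      (∑ y, if p y then pr (H.term i) y else 0) ≤ (∑ y, if p y then pr' (H.term i) y else 0) + η) :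
    H.acceptProb pr ≤ H.acceptProb pr' + η := by
  have h1 : H.acceptProb pr' + η = ∑ i, |H.coeff i| / H.norm1 *
      ((∑ y : Reg (Fin n), if outcomeSign y = -Real.sign (H.coeff i) then pr' (H.term i) y else 0) +
        η) := by
    simp only [mul_add, Finset.sum_add_distrib, ← Finset.sum_mul, sum_abs_coeff_div H hH, one_mul]
    rfl
  rw [h1]
  exact Finset.sum_le_sum fun i _ => mul_le_mul_of_nonneg_left (h i _)
    (div_nonneg (abs_nonneg _) hH.le)

lemma card_term_ne_I_le (i : Fin H.numTerms) :
    (Finset.univ.filter fun j => H.term i j ≠ XZ.I).card ≤ 2 := by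
  have h : (Finset.univ.filter fun j => H.term i j ≠ XZ.I) ⊆
      (Finset.univ.filter fun j => H.term i j = XZ.X) ∪
        Finset.univ.filter fun j => H.term i j = XZ.Z := by
    intro j hj
    simp only [Finset.mem_filter, Finset.mem_univ, true_and, Finset.mem_union] at hj ⊢
    cases hP : H.term i j
    · exact absurd hP hj
    · exact Or.inl rfl
    · exact Or.inr rfl
  exact (Finset.card_le_card h).trans ((Finset.card_union_le _ _).trans
    (Nat.add_le_add (H.weightX_le i) (H.weightZ_le i)))

lemma outcomeSign_eq (y : Reg (Fin n)) : ((outcomeSign y : ℝ) : ℂ) = ∏ i, sgn (y i) := by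
  simp only [outcomeSign, sgn, Complex.ofReal_prod]
  refine Finset.prod_congr rfl fun i _ => ?_
  split_ifs <;> simp

lemma outcomeSign_cases (y : Reg (Fin n)) : outcomeSign y = 1 ∨ outcomeSign y = -1 := by
  rw [outcomeSign]
  refine Finset.prod_induction _ (fun x : ℝ => x = 1 ∨ x = -1) ?_ (Or.inl rfl) fun i _ => ?_
  · rintro a b (rfl | rfl) (rfl | rfl) <;> simp
  · split_ifs <;> simp

lemma sum_outcomeSign_mul_outcomeProb (P : Fin n → XZ) (ρ : Op (Fin n)) :
    ∑ y, outcomeSign y * outcomeProb P ρ y =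
      (tensorOp (fun i => pauli (P i)) * ρ).trace.re := by
  have h : ∀ i, pauli (P i) = ∑ v, sgn v • effect (P i) v := by
    intro i
    rw [sum_zmod_two]
    by_cases hP : P i = XZ.I
    · simp [hP, effect, pauli]
    · rw [effect_eq hP, effect_eq hP, sgn_zero, sgn_one]
      module
  simp only [h, tensorOp_eq_piTensor]
  rw [piTensor_sum, Matrix.sum_mul, Matrix.trace_sum, Complex.re_sum]
  refine Finset.sum_congr rfl fun y _ => ?_
  rw [piTensor_smul, ← outcomeSign_eq, Matrix.smul_mul, Matrix.trace_smul, smul_eq_mul,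
    Complex.re_ofReal_mul]
  rfl

/-- The acceptance probability of the ideal protocol is an affine function of the energy. -/
lemma postHocAccept_eq (hH : 0 < H.norm1) {ρ : Op (Fin n)} (hρ : IsState ρ) :
    H.postHocAccept ρ = (1 - (H.op * ρ).trace.re / H.norm1) / 2 := by
  have h1 : ∀ i, |H.coeff i| / H.norm1 * (∑ y : Reg (Fin n),
      if outcomeSign y = -Real.sign (H.coeff i) then outcomeProb (H.term i) ρ y else 0) =
      |H.coeff i| / H.norm1 / 2 -
        H.coeff i * (tensorOp (fun j => pauli (H.term i j)) * ρ).trace.re / H.norm1 / 2 := by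
    intro i
    rcases eq_or_ne (H.coeff i) 0 with h0 | h0
    · simp [h0]
    · have hs : Real.sign (H.coeff i) = 1 ∨ Real.sign (H.coeff i) = -1 := by
        rcases h0.lt_or_gt with h | h
        · exact Or.inr (Real.sign_of_neg h)
        · exact Or.inl (Real.sign_of_pos h)
      have hind : ∀ y : Reg (Fin n), (if outcomeSign y = -Real.sign (H.coeff i) then
          outcomeProb (H.term i) ρ y else 0) = 1 / 2 * outcomeProb (H.term i) ρ y -
            Real.sign (H.coeff i) / 2 * (outcomeSign y * outcomeProb (H.term i) ρ y) := by
        intro y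
        rcases hs with hs | hs <;> rcases outcomeSign_cases y with hy | hy <;> rw [hs, hy] <;>
          norm_num <;> ring
      simp only [hind]
      rw [Finset.sum_sub_distrib, ← Finset.mul_sum, ← Finset.mul_sum, sum_outcomeProb _ hρ,
        sum_outcomeSign_mul_outcomeProb]
      have ha : H.coeff i = Real.sign (H.coeff i) * |H.coeff i| := by
        rcases h0.lt_or_gt with h | h
        · rw [Real.sign_of_neg h, abs_of_neg h]; ring
        · rw [Real.sign_of_pos h, abs_of_pos h]; ring
      generalize (tensorOp (fun j => pauli (H.term i j)) * ρ).trace.re = z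
      have hz : H.coeff i * z = Real.sign (H.coeff i) * |H.coeff i| * z := by rw [← ha]
      rw [hz]
      ring
  have h2 : (H.op * ρ).trace.re =
      ∑ i, H.coeff i * (tensorOp (fun j => pauli (H.term i j)) * ρ).trace.re := by
    rw [XZHamiltonian.op, Matrix.sum_mul, Matrix.trace_sum, Complex.re_sum]
    refine Finset.sum_congr rfl fun i _ => ?_
    rw [Matrix.smul_mul, Matrix.trace_smul, smul_eq_mul, Complex.re_ofReal_mul]
  rw [XZHamiltonian.postHocAccept, XZHamiltonian.acceptProb, Finset.sum_congr rfl fun i _ => h1 i,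
    Finset.sum_sub_distrib, ← Finset.sum_div, sum_abs_coeff_div H hH, ← Finset.sum_div,
    ← Finset.sum_div, h2]
  ring

lemma pureState_isState {κ : Type} [Fintype κ] {ψ : κ → ℂ} (hψ : IsUnitVec ψ) :
    IsState (pureState ψ) := by
  refine ⟨Matrix.posSemidef_vecMulVec_self_star ψ, ?_⟩
  rw [pureState, Matrix.trace_vecMulVec, dotProduct_comm]
  exact hψ

lemma trace_mul_pureState {κ : Type} [Fintype κ] (A : Matrix κ κ ℂ) (ψ : κ → ℂ) :
    (A * pureState ψ).trace.re = energy A ψ := by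
  rw [pureState, Matrix.mul_vecMulVec, Matrix.trace_vecMulVec, dotProduct_comm, energy]

/-- A lower bound of the energies of state vectors holds for density operators. -/
lemma le_trace_mul_of_forall_unit {κ : Type} [Fintype κ] [DecidableEq κ] {A : Matrix κ κ ℂ} {c : ℝ}
    (h : ∀ φ, IsUnitVec φ → c ≤ energy A φ) {ρ : Matrix κ κ ℂ} (hρ : IsState ρ) :
    c ≤ (A * ρ).trace.re := by
  obtain ⟨B, hB⟩ := hρ.1.exists_eq_conjTranspose_mul_self
  have h1 : ∀ M : Matrix κ κ ℂ, (M * ρ).trace =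
      ∑ i, star (fun j => star (B i j)) ⬝ᵥ (M *ᵥ fun j => star (B i j)) := by
    intro M
    rw [hB, ← Matrix.mul_assoc, Matrix.trace_mul_comm, ← Matrix.mul_assoc, Matrix.mul_assoc,
      Matrix.trace]
    refine Finset.sum_congr rfl fun i _ => ?_
    rw [Matrix.diag_apply, Matrix.mul_apply]
    simp only [dotProduct, Pi.star_apply, star_star]
    rfl
  have h2 := h1 1
  rw [Matrix.one_mul, hρ.2] at h2
  simp only [Matrix.one_mulVec] at h2
  rw [h1, Complex.re_sum]
  calc c = c * (1 : ℂ).re := by simp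
    _ = ∑ i, c * (star (fun j => star (B i j)) ⬝ᵥ fun j => star (B i j)).re := by
      rw [h2, Complex.re_sum, Finset.mul_sum]
    _ ≤ _ := Finset.sum_le_sum fun i _ => le_energy_of_forall_unit h _

variable {m : ℕ} {Q : CSSCode m}

lemma postHocAccept_sub_le_ftAccept {D : Q.Decoder} (hD : D.CorrectsSingleErrors) {r : ℕ} {ε : ℝ}
    (h0 : 0 ≤ ε) (h1 : ε ≤ 1) {K : Fin r → QubitOp} (hK : IsKraus K) (k : ℕ) {η : ℝ}
    (hη : ((m : ℝ) ^ 2) ^ (2 ^ k - 1) * ε ^ 2 ^ k ≤ η / 2) (hH : 0 < H.norm1) {ρ : Op (Fin n)}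
    (hρ : IsState ρ) : H.postHocAccept ρ - η ≤ D.ftAccept H ε K (Q.encState k ρ) := by
  rw [sub_le_iff_le_add]
  refine acceptProb_le_add H hH fun i p _ => ?_
  have hst : IsState (noise ε K (Q.encState k ρ)) := hρ.encState.noise h0 h1 hK
  refine (sum_sub_le_half_sum_abs ((sum_outcomeProb (H.term i) hρ).trans
    (sum_decodedProb D (H.term i) hst).symm) p).trans (add_le_add_right ?_ _)
  have htv := decodedProb_noise_encState_tv hD h0 h1 hK k (H.term i) hρ
  simp only [abs_sub_comm (outcomeProb _ _ _)]
  have hp : 0 ≤ ((m : ℝ) ^ 2) ^ (2 ^ k - 1) * ε ^ 2 ^ k := by positivity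
  have hw : ((Finset.univ.filter fun j => H.term i j ≠ XZ.I).card : ℝ) ≤ 2 := by
    exact_mod_cast card_term_ne_I_le H i
  have := mul_le_mul_of_nonneg_right hw hp
  linarith

/-- The noise does not help a dishonest prover: it maps the state that is sent to another state,
which has the same decoded outcomes as some state of the logical qubits. -/
lemma ftAccept_le {D : Q.Decoder} {r : ℕ} {ε : ℝ} (h0 : 0 ≤ ε) (h1 : ε ≤ 1)
    {K : Fin r → QubitOp} (hK : IsKraus K) {k : ℕ} {p : ℝ}
    (hp : ∀ ρ : Op (Fin n), IsState ρ → H.postHocAccept ρ ≤ p) {σ : Op (Fin n × Block m k)}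
    (hσ : IsState σ) : D.ftAccept H ε K σ ≤ p := by
  obtain ⟨ρ, hρ, h⟩ := exists_logical_state D (hσ.noise h0 h1 hK)
  have : D.ftAccept H ε K σ = H.postHocAccept ρ := by
    exact congrArg H.acceptProb (funext fun P => funext fun y => h P y)
  rw [this]
  exact hp ρ hρ

end Accept

/-! ### History states -/

section History

variable {w T : ℕ}

lemma circuitState_isUnitVec (U : Fin T → Matrix.unitaryGroup (Reg (Fin w)) ℂ) (x : Reg (Fin w))
    (t : ℕ) : IsUnitVec (circuitState U x t) := by
  induction t with
  | zero => simp [IsUnitVec, circuitState, Pi.single_apply, dotProduct]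
  | succ t ih =>
    rw [circuitState]
    split_ifs with h
    · exact ih.mulVec (Matrix.mem_unitaryGroup_iff'.1 (U ⟨t, h⟩).2)
    · exact ih

/-- The unary clock string `1^t 0^(T-t)`. -/
def clockString (T t : ℕ) : Reg (Fin T) := fun j => if (j : ℕ) < t then 1 else 0

lemma clockString_injOn {t t' : ℕ} (ht : t ≤ T) (ht' : t' ≤ T)
    (h : clockString T t = clockString T t') : t = t' := by
  by_contra hne
  wlog hlt : t < t' generalizing t t'
  · exact this ht' ht h.symm (Ne.symm hne) (by omega)
  have := congrFun h ⟨t, by omega⟩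
  simp [clockString, hlt] at this

lemma historyState_isUnitVec (U : Fin T → Matrix.unitaryGroup (Reg (Fin w)) ℂ) (x : Reg (Fin w)) :
    IsUnitVec (historyState U x) := by
  have hh : ∀ (a : Reg (Fin w)) (c : Reg (Fin T)), historyState U x (Fin.append a c) =
      ((Real.sqrt (T + 1))⁻¹ : ℂ) * ∑ t ∈ Finset.range (T + 1),
        circuitState U x t a * if c = clockString T t then 1 else 0 := by
    intro a c
    simp only [historyState, Fin.append_left, Fin.append_right, funext_iff, clockString]
  have hsq : ((Real.sqrt (T + 1))⁻¹ : ℂ) * ((Real.sqrt (T + 1))⁻¹ : ℂ) = ((T : ℂ) + 1)⁻¹ := by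
    rw [← mul_inv]
    congr 1
    have : Real.sqrt (T + 1) * Real.sqrt (T + 1) = (T : ℝ) + 1 :=
      Real.mul_self_sqrt (by positivity)
    exact_mod_cast this
  have hc : ∀ a : Reg (Fin w), ∑ c : Reg (Fin T),
      star (historyState U x (Fin.append a c)) * historyState U x (Fin.append a c) =
      ((T : ℂ) + 1)⁻¹ * ∑ t ∈ Finset.range (T + 1),
        star (circuitState U x t a) * circuitState U x t a := by
    intro a
    have h1 : ∀ c : Reg (Fin T),
        star (historyState U x (Fin.append a c)) * historyState U x (Fin.append a c) =
        ∑ t ∈ Finset.range (T + 1), ∑ t' ∈ Finset.range (T + 1), ((T : ℂ) + 1)⁻¹ *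
          (star (circuitState U x t a) * circuitState U x t' a) *
          (if c = clockString T t then if c = clockString T t' then 1 else 0 else 0) := by
      intro c
      rw [hh, star_mul', star_sum, mul_mul_mul_comm, ← hsq, Finset.sum_mul_sum, Finset.mul_sum]
      refine Finset.sum_congr rfl fun t _ => ?_
      rw [Finset.mul_sum]
      refine Finset.sum_congr rfl fun t' _ => ?_
      have : star ((Real.sqrt (T + 1))⁻¹ : ℂ) = ((Real.sqrt (T + 1))⁻¹ : ℂ) := by
        simp
      rw [this]
      split_ifs <;> simp
    simp only [h1]
    rw [Finset.sum_comm, Finset.mul_sum]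
    refine Finset.sum_congr rfl fun t ht => ?_
    rw [Finset.sum_comm, Finset.sum_eq_single t]
    · rw [← Finset.mul_sum]
      simp
    · intro t' ht' hne
      rw [← Finset.mul_sum]
      have : clockString T t ≠ clockString T t' := fun h =>
        hne (clockString_injOn (Nat.lt_succ_iff.1 (Finset.mem_range.1 ht))
          (Nat.lt_succ_iff.1 (Finset.mem_range.1 ht')) h).symm
      simp [this]
    · exact fun h => absurd ht h
  rw [IsUnitVec, dotProduct, ← Equiv.sum_comp (Fin.appendEquiv w T), Fintype.sum_prod_type]
  change ∑ a, ∑ c, star (historyState U x (Fin.append a c)) *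
    historyState U x (Fin.append a c) = 1
  rw [Finset.sum_congr rfl fun a _ => hc a, ← Finset.mul_sum, Finset.sum_comm]
  have h2 : ∀ t, ∑ a, star (circuitState U x t a) * circuitState U x t a = 1 :=
    fun t => circuitState_isUnitVec U x t
  simp only [h2, Finset.sum_const, Finset.card_range, nsmul_eq_mul, mul_one]
  push_cast
  exact inv_mul_cancel₀ (by exact_mod_cast Nat.succ_ne_zero T)

end History

/-! ### Completeness and soundness from energy bounds -/

section Energy

variable {n m : ℕ} {Q : CSSCode m} (H : XZHamiltonian n)

lemma ftAccept_ge_of_energy_le {D : Q.Decoder} (hD : D.CorrectsSingleErrors) {r : ℕ} {ε : ℝ}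
    (h0 : 0 ≤ ε) (h1 : ε ≤ 1) {K : Fin r → QubitOp} (hK : IsKraus K) {k : ℕ} {η : ℝ}
    (hη : ((m : ℝ) ^ 2) ^ (2 ^ k - 1) * ε ^ 2 ^ k ≤ η / 2) (hH : 0 < H.norm1) {b : ℝ}
    {ψ : Reg (Fin n) → ℂ} (hψ : IsUnitVec ψ) (hb : energy H.op ψ ≤ b) :
    (1 - b / H.norm1) / 2 - η ≤ D.ftAccept H ε K (Q.encState k (pureState ψ)) := by
  have h := postHocAccept_sub_le_ftAccept H hD h0 h1 hK k hη hH (pureState_isState hψ)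
  rw [postHocAccept_eq H hH (pureState_isState hψ), trace_mul_pureState] at h
  have h2 : energy H.op ψ / H.norm1 ≤ b / H.norm1 := by gcongr
  linarith

lemma ftAccept_le_of_le_energy {D : Q.Decoder} {r : ℕ} {ε : ℝ} (h0 : 0 ≤ ε) (h1 : ε ≤ 1)
    {K : Fin r → QubitOp} (hK : IsKraus K) {k : ℕ} (hH : 0 < H.norm1) {a : ℝ}
    (ha : ∀ φ, IsUnitVec φ → a ≤ energy H.op φ) {σ : Op (Fin n × Block m k)} (hσ : IsState σ) :
    D.ftAccept H ε K σ ≤ (1 - a / H.norm1) / 2 := by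
  refine ftAccept_le H h0 h1 hK (fun ρ hρ => ?_) hσ
  rw [postHocAccept_eq H hH hρ]
  have h2 : a / H.norm1 ≤ (H.op * ρ).trace.re / H.norm1 := by
    gcongr
    exact le_trace_mul_of_forall_unit ha hρ
  linarith

end Energy

/-! ### The number of levels -/

section Levels

/-- The least number of levels with `2 ^ k ≥ log (2 / (α η)) / log (1 / (α ε))` suffices. -/
lemma exists_levels_of_pos {m : ℕ} (hm : 0 < m) {α ε η : ℝ} (hα : 0 < α) (hε : 0 < ε)
    (hαε : α * ε < 1) (hη : 0 < η) : ∃ k : ℕ, α ^ (2 ^ k - 1) * ε ^ 2 ^ k ≤ η / 2 ∧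
      (m : ℝ) ^ k ≤
        m * (max 1 (Real.log (2 / (α * η)) / Real.log (1 / (α * ε)))) ^ Real.logb 2 m := by
  set L := Real.log (1 / (α * ε)) with hL
  set x := Real.log (2 / (α * η)) / L with hx
  have hαε0 : 0 < α * ε := mul_pos hα hε
  have hL0 : 0 < L := Real.log_pos (by rw [lt_div_iff₀ hαε0]; linarith)
  have hm1 : (1 : ℝ) ≤ m := by exact_mod_cast hm
  have hex : ∃ k : ℕ, x ≤ 2 ^ k := by
    obtain ⟨k, hk⟩ := pow_unbounded_of_one_lt x (one_lt_two (α := ℝ))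
    exact ⟨k, hk.le⟩
  classical
  refine ⟨Nat.find hex, ?_, ?_⟩
  · have hk := Nat.find_spec hex
    set k := Nat.find hex
    have h1 : α ^ (2 ^ k - 1) * ε ^ 2 ^ k = (α * ε) ^ 2 ^ k / α := by
      obtain ⟨j, hj⟩ : ∃ j, 2 ^ k = j + 1 :=
        ⟨2 ^ k - 1, (Nat.sub_add_cancel Nat.one_le_two_pow).symm⟩
      rw [hj, Nat.add_sub_cancel, mul_pow, pow_succ α]
      field_simp
    have h2 : (α * ε) ^ 2 ^ k ≤ α * η / 2 := by
      rw [← Real.log_le_log_iff (by positivity) (by positivity), Real.log_pow]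
      have h3 : Real.log (α * η / 2) = -Real.log (2 / (α * η)) := by
        rw [← Real.log_inv, inv_div]
      have h4 : Real.log (α * ε) = -L := by rw [hL, ← Real.log_inv, one_div, inv_inv]
      rw [hx, div_le_iff₀ hL0] at hk
      rw [h3, h4]
      push_cast
      linarith
    rw [h1, div_le_iff₀ hα]
    linarith
  · have hr : 0 ≤ Real.logb 2 m := Real.logb_nonneg one_lt_two hm1
    have hmax : 1 ≤ (max 1 x) ^ Real.logb 2 m := Real.one_le_rpow (le_max_left _ _) hr
    rcases hk : Nat.find hex with _ | j
    · rw [pow_zero]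
      nlinarith
    · have hj : (2 : ℝ) ^ j < x := not_le.1 (Nat.find_min hex (by omega))
      have hmj : (m : ℝ) ^ j = ((2 : ℝ) ^ j) ^ Real.logb 2 m := by
        rw [← Real.rpow_natCast 2 j, ← Real.rpow_mul (by norm_num), mul_comm,
          Real.rpow_mul (by norm_num), Real.rpow_logb (by norm_num) (by norm_num) (by linarith),
          Real.rpow_natCast]
      rw [pow_succ, mul_comm, hmj]
      gcongr
      exact hj.le.trans (le_max_right _ _)

lemma exists_levels {m : ℕ} (hm : 0 < m) {α ε : ℝ} (hα : 1 ≤ α) (hε : 0 ≤ ε) (hαε : α * ε < 1) :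
    ∃ (C : ℝ) (c : ℕ), 0 ≤ C ∧ ∀ η : ℝ, 0 < η → η ≤ 1 → ∃ k : ℕ,
      α ^ (2 ^ k - 1) * ε ^ 2 ^ k ≤ η / 2 ∧ ((m : ℝ) ^ k ≤ C * Real.log (2 / η) ^ c) ∧
        (0 < ε → (m : ℝ) ^ k ≤
          m * (max 1 (Real.log (2 / (α * η)) / Real.log (1 / (α * ε)))) ^ Real.logb 2 m) := by
  rcases hε.eq_or_lt with rfl | hε
  · -- without noise no encoding is needed
    refine ⟨1, 0, zero_le_one, fun η hη _ => ⟨0, ?_, by simp, fun h => absurd h (lt_irrefl _)⟩⟩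
    simpa using (half_pos hη).le
  · have hα0 : 0 < α := by linarith
    have hαε0 : 0 < α * ε := mul_pos hα0 hε
    set L := Real.log (1 / (α * ε)) with hL
    have hL0 : 0 < L := Real.log_pos (by rw [lt_div_iff₀ hαε0]; linarith)
    have hlog2 : 0 < Real.log 2 := Real.log_pos one_lt_two
    set M := 1 / Real.log 2 + 1 / L with hM
    have hM0 : 0 ≤ M := by positivity
    set c := ⌈Real.logb 2 m⌉₊ with hc
    refine ⟨m * M ^ c, c, by positivity, fun η hη hη1 => ?_⟩
    obtain ⟨k, hk1, hk2⟩ := exists_levels_of_pos hm hα0 hε hαε hη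
    refine ⟨k, hk1, hk2.trans ?_, fun _ => hk2⟩
    set y := Real.log (2 / η) with hy
    have hy2 : Real.log 2 ≤ y := by
      refine Real.log_le_log (by norm_num) ?_
      rw [le_div_iff₀ hη]
      linarith
    have hxy : Real.log (2 / (α * η)) ≤ y := by
      refine Real.log_le_log (by positivity) ?_
      gcongr
      nlinarith
    have hy0 : 0 < y := by linarith
    have hmax : max 1 (Real.log (2 / (α * η)) / L) ≤ y * M := by
      have h1 : 1 ≤ y * (1 / Real.log 2) := by rw [mul_one_div, le_div_iff₀ hlog2]; linarith
      have h2 : Real.log (2 / (α * η)) / L ≤ y * (1 / L) := by rw [mul_one_div]; gcongr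
      have h3 : 0 ≤ y * (1 / L) := by positivity
      rw [hM, mul_add]
      exact max_le (by linarith) (by linarith)
    calc (m : ℝ) * (max 1 (Real.log (2 / (α * η)) / L)) ^ Real.logb 2 m
        ≤ m * (max 1 (Real.log (2 / (α * η)) / L)) ^ (c : ℝ) := by
          gcongr
          · exact le_max_left _ _
          · exact Nat.le_ceil _
      _ ≤ m * (y * M) ^ c := by
          rw [Real.rpow_natCast]
          gcongr
      _ = m * M ^ c * y ^ c := by rw [mul_pow]; ring

end Levels

/-! ### Encoding, threshold and promise gap -/

theorem theorem1 {m : ℕ} (Q : CSSCode m) :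
    -- (1) the encoded Hamiltonian, for every number `k` of levels of concatenation
    (∀ k : ℕ,
      (∀ q₀ : Block m k, ∃ E ∈ Matrix.unitaryGroup (Reg (Block m k)) ℂ,
        (∀ P : XZ, E * tensorOp (fun q => if q = q₀ then pauli P else 1) * Eᴴ =
          tensorOp (fun q => pauli (Q.logical k P q))) ∧
        ∀ n : ℕ,
          blockPow n E ∈ Matrix.unitaryGroup (Reg (Fin n × Block m k)) ℂ ∧
          (∀ H : XZHamiltonian n,
            blockPow n E * H.opTensorId q₀ * (blockPow n E)ᴴ = Q.encHam k H) ∧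
          ∀ ψ : Reg (Fin n) → ℂ, blockPow n E *ᵥ withAncilla q₀ ψ = Q.encReg n k *ᵥ ψ) ∧
      ∀ (n : ℕ) (H : XZHamiltonian n),
        spectrum ℂ (Q.encHam k H) = spectrum ℂ H.op ∧
        (∀ c : ℝ, (∀ φ, IsUnitVec φ → c ≤ energy H.op φ) ↔
          ∀ φ, IsUnitVec φ → c ≤ energy (Q.encHam k H) φ) ∧
        (∀ ψ, energy (Q.encHam k H) (Q.encReg n k *ᵥ ψ) = energy H.op ψ) ∧
        (∀ ψ, IsGroundState H.op ψ → IsGroundState (Q.encHam k H) (Q.encReg n k *ᵥ ψ))) ∧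
    -- (2) noise; the constant `α` is determined by the code, the threshold is `1 / α`
    ∃ α : ℝ, 0 < α ∧
      ∀ D : Q.Decoder, D.CorrectsSingleErrors →
      -- suppression of the logical error by `k` levels of concatenation
      (∀ (ε : ℝ), 0 ≤ ε → ε ≤ 1 → ∀ (r : ℕ) (K : Fin r → QubitOp), IsKraus K → ∀ k : ℕ,
        (∀ P : XZ, P ≠ XZ.I → ∀ v : ZMod 2,
          D.decodedProb (fun _ : Fin 1 => P)
            (noise ε K (Q.encState k (tensorOp fun _ : Fin 1 => effect P v))) (fun _ => v + 1) ≤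
              α ^ (2 ^ k - 1) * ε ^ 2 ^ k) ∧
        (∀ (n : ℕ) (P : Fin n → XZ) (ρ : Op (Fin n)), IsState ρ →
          (1 / 2 : ℝ) * ∑ y, |D.decodedProb P (noise ε K (Q.encState k ρ)) y - outcomeProb P ρ y| ≤
            (Finset.univ.filter fun i => P i ≠ XZ.I).card * (α ^ (2 ^ k - 1) * ε ^ 2 ^ k)) ∧
        -- correctness and soundness up to `η`
        ∀ η : ℝ, α ^ (2 ^ k - 1) * ε ^ 2 ^ k ≤ η / 2 →
          ∀ (n : ℕ) (H : XZHamiltonian n), 0 < H.norm1 →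
            (∀ ρ : Op (Fin n), IsState ρ →
              H.postHocAccept ρ - η ≤ D.ftAccept H ε K (Q.encState k ρ)) ∧
            (∀ p : ℝ, (∀ ρ : Op (Fin n), IsState ρ → H.postHocAccept ρ ≤ p) →
              ∀ σ : Op (Fin n × Block m k), IsState σ → D.ftAccept H ε K σ ≤ p + η)) ∧
      -- below threshold
      (∀ ε : ℝ, 0 ≤ ε → ε ≤ 1 → α * ε < 1 →
        -- polylogarithmic block size
        (∃ C c : ℝ, ∀ η : ℝ, 0 < η → η ≤ 1 → ∃ k : ℕ,
          α ^ (2 ^ k - 1) * ε ^ 2 ^ k ≤ η / 2 ∧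
          ((m : ℝ) ^ k ≤ C * Real.log (2 / η) ^ c) ∧
          (0 < ε → (m : ℝ) ^ k ≤
            m * (max 1 (Real.log (2 / (α * η)) / Real.log (1 / (α * ε)))) ^ Real.logb 2 m)) ∧
        -- the inverse polynomial gap persists, with polylogarithmic overhead
        ∀ d e : ℕ, ∃ (levels : ℕ → ℕ) (η : ℕ → ℝ) (d' c : ℕ) (C : ℝ),
          (∀ N n : ℕ, (Fintype.card (Fin n × Block m (levels N)) : ℝ) ≤
            n * (C * Real.log ((N : ℝ) + 2) ^ c)) ∧
          (∀ (N n : ℕ) (H : XZHamiltonian n) (a b : ℝ), HasPromiseGap H a b d e N →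
            1 / ((N : ℝ) + 2) ^ d' ≤
              ((1 - b / H.norm1) / 2 - η N) - ((1 - a / H.norm1) / 2 + η N) ∧
            ∀ (r : ℕ) (K : Fin r → QubitOp), IsKraus K →
              (∀ ψ, IsUnitVec ψ → energy H.op ψ ≤ b →
                (1 - b / H.norm1) / 2 - η N ≤
                  D.ftAccept H ε K (Q.encState (levels N) (pureState ψ))) ∧
              ((∀ φ, IsUnitVec φ → a ≤ energy H.op φ) →
                ∀ σ : Op (Fin n × Block m (levels N)), IsState σ →
                  D.ftAccept H ε K σ ≤ (1 - a / H.norm1) / 2 + η N)) ∧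
          -- in particular for the post hoc scheme of a language, with history states
          (∀ (L : Set (List Bool)) (S : PostHocScheme), S.IsFor L →
            (∀ x, HasPromiseGap (S.ham x) (S.a x) (S.b x) d e x.length) →
            ∀ (r : ℕ) (K : Fin r → QubitOp), IsKraus K → ∀ x : List Bool,
              (x ∈ L → (1 - S.b x / (S.ham x).norm1) / 2 - η x.length ≤
                D.ftAccept (S.ham x) ε K
                  (Q.encState (levels x.length) (pureState (S.witness x)))) ∧
              (x ∉ L → ∀ σ : Op (Fin (S.width x + S.depth x) × Block m (levels x.length)),
                IsState σ →
                  D.ftAccept (S.ham x) ε K σ ≤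
                    (1 - S.a x / (S.ham x).norm1) / 2 + η x.length))) := by
  have hm : 0 < m := code_length_pos Q
  have hm1 : (1 : ℝ) ≤ m := by exact_mod_cast hm
  have hα : (1 : ℝ) ≤ (m : ℝ) ^ 2 := one_le_pow₀ hm1
  refine ⟨fun k => ⟨fun q₀ => ?_, fun n H => ?_⟩, (m : ℝ) ^ 2, by positivity, fun D hD =>
    ⟨fun ε h0 h1 r K hK k => ⟨fun P hP v => ?_, fun n P ρ hρ => ?_, fun η hη n H hH =>
      ⟨fun ρ hρ => ?_, fun p hp σ hσ => ?_⟩⟩, fun ε h0 h1 hαε => ⟨?_, fun d e => ?_⟩⟩⟩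
  · obtain ⟨E, hE, hEP, hEV⟩ := exists_unitary_encoding (w := Q.blockWord k)
      (blockWord_X_dot_Z Q k) (concatEnc_isometry Q k) (fun s b a => concatEnc_shift Q k s a b)
      (fun s b => concatEnc_support Q k) q₀
    have hEP' : ∀ P : XZ, E * tensorOp (fun q => if q = q₀ then pauli P else 1) * Eᴴ =
        tensorOp (fun q => pauli (Q.logical k P q)) := by
      intro P
      simp only [hEP, CSSCode.logical_eq]
    refine ⟨E, hE, hEP', fun n => ⟨blockPow_mem_unitaryGroup n hE, fun H => ?_, fun ψ =>
      blockPow_mulVec_withAncilla n E hEV ψ⟩⟩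
    rw [XZHamiltonian.opTensorId, CSSCode.encHam, Matrix.mul_sum, Matrix.sum_mul]
    refine Finset.sum_congr rfl fun i _ => ?_
    rw [Matrix.mul_smul, Matrix.smul_mul, blockPow_conj, tensorOp_eq_submatrix (Equiv.refl _)]
    simp only [hEP', Equiv.refl_apply]
  · obtain ⟨W, h1, hW⟩ := exists_copies_encHam Q n k
    have hV := encReg_isometry Q n k
    have hHV := encHam_mul_encReg Q (k := k) H
    have hbound := energy_bound_iff (hW H) h1 hV hHV
    refine ⟨spectrum_eq_of_copies (hW H) h1 hV hHV, hbound, fun ψ => energy_mulVec hV hHV ψ,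
      fun ψ hψ => ⟨hψ.1.mulVec hV, ?_⟩⟩
    rw [energy_mulVec hV hHV]
    exact (hbound _).1 hψ.2
  · exact decodedProb_noise_eigenstate_le hD h0 h1 hK k hP v
  · exact decodedProb_noise_encState_tv hD h0 h1 hK k P hρ
  · exact postHocAccept_sub_le_ftAccept H hD h0 h1 hK k hη hH hρ
  · have hp0 : 0 ≤ ((m : ℝ) ^ 2) ^ (2 ^ k - 1) * ε ^ 2 ^ k := by positivity
    exact (ftAccept_le H h0 h1 hK hp hσ).trans (by linarith)
  · obtain ⟨C, c, -, h⟩ := exists_levels hm hα h0 hαε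
    refine ⟨C, c, fun η hη hη1 => ?_⟩
    obtain ⟨k, hk1, hk2, hk3⟩ := h η hη hη1
    exact ⟨k, hk1, by rwa [Real.rpow_natCast], hk3⟩
  · obtain ⟨C, c, hC, h⟩ := exists_levels hm hα h0 hαε
    set X : ℕ → ℝ := fun N => ((N : ℝ) + 2) ^ (d + e) with hX
    have hN2 : ∀ N : ℕ, (2 : ℝ) ≤ (N : ℝ) + 2 := fun N => by
      linarith [(Nat.cast_nonneg N : (0 : ℝ) ≤ N)]
    have hX1 : ∀ N, 1 ≤ X N := fun N => one_le_pow₀ (by linarith [hN2 N])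
    have hX0 : ∀ N, 0 < X N := fun N => by linarith [hX1 N]
    have hη0 : ∀ N, 0 < 1 / (8 * X N) := fun N => by have := hX0 N; positivity
    have hη1 : ∀ N, 1 / (8 * X N) ≤ 1 := fun N => by
      rw [div_le_one (by linarith [hX1 N])]
      linarith [hX1 N]
    choose levels hl1 hl2 _ using fun N => h (1 / (8 * X N)) (hη0 N) (hη1 N)
    refine ⟨levels, fun N => 1 / (8 * X N), d + e + 2, c, C * ((d + e + 4 : ℕ) : ℝ) ^ c,
      fun N n => ?_, fun N n H a b hgap => ⟨?_, fun r K hK => ⟨fun ψ hψ hb => ?_,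
        fun ha σ hσ => ?_⟩⟩, fun L S hS hgap r K hK x => ⟨fun hx => ?_, fun hx σ hσ => ?_⟩⟩
    · have hlog : Real.log (2 / (1 / (8 * X N))) ≤
          ((d + e + 4 : ℕ) : ℝ) * Real.log ((N : ℝ) + 2) := by
        rw [← Real.log_pow]
        refine Real.log_le_log (by have := hX0 N; positivity) ?_
        have h16 : (2 : ℝ) ^ 4 ≤ ((N : ℝ) + 2) ^ 4 := pow_le_pow_left₀ (by norm_num) (hN2 N) 4
        rw [div_div_eq_mul_div, div_one, pow_add _ (d + e) 4]
        nlinarith [hX0 N]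
      have hlog0 : 0 ≤ Real.log (2 / (1 / (8 * X N))) := by
        refine Real.log_nonneg ?_
        rw [div_div_eq_mul_div, div_one]
        linarith [hX1 N]
      have hcard : (Fintype.card (Fin n × Block m (levels N)) : ℝ) = n * (m : ℝ) ^ levels N := by
        simp
      rw [hcard]
      refine mul_le_mul_of_nonneg_left ((hl2 N).trans ?_) n.cast_nonneg
      rw [mul_assoc, ← mul_pow]
      gcongr
    · obtain ⟨hM, hMe, hab⟩ := hgap
      have hx0 : (0 : ℝ) < (N : ℝ) + 2 := by linarith [hN2 N]
      have h2 : 1 / X N ≤ (a - b) / H.norm1 := by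
        have hXN : X N = ((N : ℝ) + 2) ^ d * ((N : ℝ) + 2) ^ e := pow_add _ d e
        rw [hXN, ← div_div]
        exact div_le_div₀ (le_trans (by positivity) hab) hab hM hMe
      have h3 : 1 / ((N : ℝ) + 2) ^ (d + e + 2) ≤ 1 / X N / 4 := by
        rw [div_div, pow_add _ (d + e) 2]
        refine one_div_le_one_div_of_le (by linarith [hX0 N]) ?_
        exact mul_le_mul_of_nonneg_left (by nlinarith [hN2 N]) (hX0 N).le
      have h4 : 1 / (8 * X N) = 1 / X N / 8 := by rw [div_div, mul_comm]
      rw [sub_div] at h2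
      simp only [h4]
      linarith
    · exact ftAccept_ge_of_energy_le H hD h0 h1 hK (hl1 N) hgap.1 hψ hb
    · exact (ftAccept_le_of_le_energy H h0 h1 hK hgap.1 ha hσ).trans (by linarith [hη0 N])
    · exact ftAccept_ge_of_energy_le _ hD h0 h1 hK (hl1 x.length) (hgap x).1
        (historyState_isUnitVec _ _) (hS.1 x hx)
    · exact (ftAccept_le_of_le_energy _ h0 h1 hK (hgap x).1 (hS.2 x hx) hσ).trans
        (by linarith [hη0 x.length])
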